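/- Let $B$ be a regular connected Noetherian scheme and let $\mathcal C$ be a category of separated schemes of finite type over $B$ such that every closed immersion $Y\hookrightarrow X$ and every open immersion $V\hookrightarrow X$ into an object $X$ of $\mathcal C$ is a morphism of $\mathcal C$. For $X\in\mathcal C$ let $\dim(X)$ be the Krull dimension of any compactification of $X$ over $B$ (a proper $B$-scheme containing $X$ as a dense open subscheme). Closed subsets and differences of closed subsets carry their reduced scheme structure. Let $H=\{H_a\}_{a\in\mathbb Z}$ be a homology theory on $\mathcal C$ with values in modules over a ring: covariant functors $H_a$ for proper morphisms of $\mathcal C$, with functorial restriction maps $j^*$ for open immersions, and with a long exact localization sequence $$\cdots\to H_a(Y)\xrightarrow{i_*}H_a(X)\xrightarrow{j^*}H_a(V)\xrightarrow{\partial}H_{a-1}(Y)\to\cdots$$ for every closed immersion $i:Y\hookrightarrow X$ with open complement $j:V\hookrightarrow X$, functorial for open immersions and for proper morphisms of pairs $f:(X',Y')\to(X,Y)$ with $f(Y')\subset Y$. (Functoriality means that $j^*f_*=f_*j^*$ for $V\subset X$ open and $f^{-1}(V)\subset X'$; that $\partial$ commutes with restriction to open subschemes of $X$; and that $H_a(X'\setminus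 Y')\xrightarrow{\partial}H_{a-1}(Y')\xrightarrow{f_*}H_{a-1}(Y)$ equals $H_a(X'\setminus Y')\to H_a(X'\setminus f^{-1}(Y))\xrightarrow{f_*}H_a(X\setminus Y)\xrightarrow{\partial}H_{a-1}(Y)$.) For $p\in\mathbb Z$ let $H_n(\mathcal Z_p(X))=\varinjlim H_n(Z)$ over the closed subsets $Z\subset X$ of dimension $\le p$, and $H_n(\mathcal Z_p/\mathcal Z_{p-1}(X))=\varinjlim H_n(Z\setminus Z')$ over the pairs of closed subsets $Z'\subset Z$ with $\dim Z\le p$ and $\dim Z'\le p-1$. The localization sequences give natural maps $$H_n(\mathcal Z_{p-1}(X))\to H_n(\mathcal Z_p(X))\xrightarrow{\pi}H_n(\mathcal Z_p/\mathcal Z_{p-1}(X))\xrightarrow{\delta}H_{n-1}(\mathcal Z_{p-1}(X)).$$ In the resulting niveau spectral sequence, $E^1_{p,q}(X)=H_{p+q}(\mathcal Z_p/\mathcal Z_{p-1}(X))$ and, for $r\ge 0$, $$Z^r_{p,q}(X)=\delta^{-1}\bigl(\operatorname{Im}(H_{p+q-1}(\mathcal Z_{p-1-r}(X))\to H_{p+q-1}(\mathcal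 Z_{p-1}(X)))\bigr),\qquad Z^\infty_{p,q}(X)=\bigcap_{r\ge0}Z^r_{p,q}(X),$$ $$B^r_{p,q}(X)=\pi\bigl(\operatorname{Ker}(H_{p+q}(\mathcal Z_p(X))\to H_{p+q}(\mathcal Z_{p+r}(X)))\bigr)\subset Z^\infty_{p,q}(X).$$ Let $X\in\mathcal C$, let $i:Y\hookrightarrow X$ be a closed immersion and let $j:V=X\setminus Y\hookrightarrow X$ be its open complement. Pushforward along $i$ and restriction along $j$ induce maps $i_*$ and $j^*$ of these spectral sequences. **Theorem 1.2 (Fundamental Lemma).** Fix integers $p,q\ge 0$ and suppose there is an integer $e\ge 1-q$ such that $$Z^\infty_{p-a,q+a}(V)/B^{q+a+e}_{p-a,q+a}(V)=0\quad\text{for all }a\ge 1,$$ $$Z^\infty_{p-a,q+a}(Y)/B^{q+a+e}_{p-a,q+a}(Y)=0\quad\text{for all integers }a\text{ with }-(q+e-1)\le a\le -1.$$ Then the sequence $$Z^\infty_{p,q}(Y)/B^{q+e}_{p,q}(Y)\xrightarrow{i_*}Z^\infty_{p,q}(X)/B^{q+e}_{p,q}(X)\xrightarrow{j^*}Z^\infty_{p,q}(V)/B^{q+e}_{p,q}(V)$$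 is exact. -/

import Mathlib

open CategoryTheory AlgebraicGeometry TopologicalSpace

universe u v w

namespace Niveau

/-! ### Reduced schemes and immersions -/

theorem exists_lift_of_range_subset {A S X : Scheme.{u}} (a : A ⟶ X) (s : S ⟶ X) [AlgebraicGeometry.IsReduced A]
    [IsImmersion s] (h : Set.range a ⊆ Set.range s) : ∃ l : A ⟶ S, l ≫ s = a := by
  have hsurj : Function.Surjective (Limits.pullback.fst a s) := by
    intro x
    obtain ⟨y, hy⟩ := h ⟨x, rfl⟩
    obtain ⟨z, hz, -⟩ := Scheme.Pullback.exists_preimage_pullback x y hy.symm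
    exact ⟨z, hz⟩
  have : IsClosedImmersion (Limits.pullback.fst a s) :=
    IsClosedImmersion.of_isPreimmersion _ (by rw [hsurj.range_eq]; exact isClosed_univ)
  have : Surjective (Limits.pullback.fst a s) := ⟨hsurj⟩
  have := isIso_of_isClosedImmersion_of_surjective (Limits.pullback.fst a s)
  exact ⟨inv (Limits.pullback.fst a s) ≫ Limits.pullback.snd a s, by
    rw [Category.assoc, ← Limits.pullback.condition, IsIso.inv_hom_id_assoc]⟩

theorem isReduced_subscheme_vanishingIdeal {X : Scheme.{u}} (Z : Closeds X) :
    AlgebraicGeometry.IsReduced (Scheme.IdealSheafData.vanishingIdeal Z).subscheme := by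
  have (U : X.affineOpens) : AlgebraicGeometry.IsReduced ((Scheme.IdealSheafData.vanishingIdeal Z).subschemeCover.openCover.X U) := by
    have : _root_.IsReduced (Γ(X, U) ⧸ (Scheme.IdealSheafData.vanishingIdeal Z).ideal U) := by
      rw [← Ideal.isRadical_iff_quotient_reduced]
      exact PrimeSpectrum.isRadical_vanishingIdeal _
    change AlgebraicGeometry.IsReduced (Spec (.of (Γ(X, U) ⧸ (Scheme.IdealSheafData.vanishingIdeal Z).ideal U)))
    infer_instance
  have (i : (Scheme.IdealSheafData.vanishingIdeal Z).subschemeCover.openCover.I₀) :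
      AlgebraicGeometry.IsReduced
        ((Scheme.IdealSheafData.vanishingIdeal Z).subschemeCover.openCover.X i) := this i
  exact AlgebraicGeometry.IsReduced.of_openCover _
    (Scheme.IdealSheafData.vanishingIdeal Z).subschemeCover.openCover

theorem isClosedImmersion_of_comp {A S X : Scheme.{u}} (l : A ⟶ S) (s : S ⟶ X) [IsImmersion s]
    [IsImmersion (l ≫ s)] {F : Set X} (hF : IsClosed F)
    (h : Set.range (l ≫ s) = Set.range s ∩ F) : IsClosedImmersion l := by
  have : IsPreimmersion l := IsPreimmersion.of_comp l s
  refine IsClosedImmersion.of_isPreimmersion _ ?_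
  have : Set.range l = s ⁻¹' F := by
    ext y
    have := Set.ext_iff.1 h (s y)
    constructor
    · rintro ⟨x, rfl⟩
      exact (this.1 ⟨x, by simp⟩).2
    · intro hy
      obtain ⟨x, hx⟩ := this.2 ⟨⟨y, rfl⟩, hy⟩
      exact ⟨x, s.isEmbedding.injective (by simpa using hx)⟩
  rw [this]
  exact hF.preimage s.continuous

theorem isOpenImmersion_of_comp {A S X : Scheme.{u}} (l : A ⟶ S) (s : S ⟶ X) [IsImmersion s]
    [IsImmersion (l ≫ s)] [AlgebraicGeometry.IsReduced S] {U : Set X} (hU : IsOpen U)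
    (h : Set.range (l ≫ s) = Set.range s ∩ U) : IsOpenImmersion l := by
  have : IsPreimmersion l := IsPreimmersion.of_comp l s
  have hr : Set.range l = s ⁻¹' U := by
    ext y
    have := Set.ext_iff.1 h (s y)
    constructor
    · rintro ⟨x, rfl⟩
      exact (this.1 ⟨x, by simp⟩).2
    · intro hy
      obtain ⟨x, hx⟩ := this.2 ⟨⟨y, rfl⟩, hy⟩
      exact ⟨x, s.isEmbedding.injective (by simpa using hx)⟩
  let W : S.Opens := ⟨s ⁻¹' U, hU.preimage s.continuous⟩
  have hl : Set.range l ⊆ Set.range W.ι := by rw [hr]; simp [W]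
  let l' : A ⟶ W := IsOpenImmersion.lift W.ι l hl
  have hl' : l' ≫ W.ι = l := IsOpenImmersion.lift_fac _ _ _
  have hsurj : Function.Surjective l' := by
    intro x
    have hx : W.ι x ∈ Set.range l := by rw [hr]; exact x.2
    obtain ⟨y, hy⟩ := hx
    refine ⟨y, W.ι.isEmbedding.injective ?_⟩
    rw [← Scheme.Hom.comp_apply, hl', hy]
  have : IsPreimmersion (l' ≫ W.ι) := by rw [hl']; infer_instance
  have : IsPreimmersion l' := IsPreimmersion.of_comp l' W.ι
  have : IsClosedImmersion l' :=
    IsClosedImmersion.of_isPreimmersion _ (by rw [hsurj.range_eq]; exact isClosed_univ)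
  have : Surjective l' := ⟨hsurj⟩
  have : AlgebraicGeometry.IsReduced W.toScheme := isReduced_of_isOpenImmersion W.ι
  have := isIso_of_isClosedImmersion_of_surjective l'
  rw [← hl']
  infer_instance

/-! ### The category of schemes over the base -/

/-- A (not necessarily full) category of separated schemes of finite type over `B` such that
every closed immersion and every open immersion into one of its objects belongs to it. -/
structure SchemeCat (B : Scheme.{u}) where
  /-- the objects -/
  obj : ObjectProperty (Over B)
  /-- the morphisms (only those between objects matter) -/
  hom : MorphismProperty (Over B)
  separated : ∀ X, obj X → IsSeparated X.hom
  locallyOfFiniteType : ∀ X, obj X → LocallyOfFiniteType X.hom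
  quasiCompact : ∀ X, obj X → QuasiCompact X.hom
  comp_mem : ∀ {X Y Z : Over B} (f : X ⟶ Y) (g : Y ⟶ Z),
    obj X → obj Y → obj Z → hom f → hom g → hom (f ≫ g)
  closed_obj : ∀ {Y X : Over B} (i : Y ⟶ X), obj X → IsClosedImmersion i.left → obj Y
  closed_hom : ∀ {Y X : Over B} (i : Y ⟶ X), obj X → IsClosedImmersion i.left → hom i
  open_obj : ∀ {V X : Over B} (j : V ⟶ X), obj X → IsOpenImmersion j.left → obj V
  open_hom : ∀ {V X : Over B} (j : V ⟶ X), obj X → IsOpenImmersion j.left → hom j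

variable {B : Scheme.{u}}

/-- The objects of the category `C`. -/
abbrev SchemeCat.Obj (C : SchemeCat B) : Type (u + 1) := {X : Over B // C.obj X}

/-- `f` is a proper morphism of `C`, i.e. a morphism of the category `C_*`. -/
def SchemeCat.IsProperHom (C : SchemeCat B) {X Y : C.Obj} (f : X.1 ⟶ Y.1) : Prop :=
  C.hom f ∧ IsProper f.left

/-- `i` is a closed immersion and `j` is its open complement. -/
structure IsClosedOpenPair {X Y V : Over B} (i : Y ⟶ X) (j : V ⟶ X) : Prop where
  closed : IsClosedImmersion i.left
  isOpen : IsOpenImmersion j.left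
  range_eq : Set.range j.left = (Set.range i.left)ᶜ

variable {C : SchemeCat B}

theorem SchemeCat.isProperHom_id (X : C.Obj) : C.IsProperHom (𝟙 X.1) :=
  ⟨C.closed_hom _ X.2 (by rw [Over.id_left]; infer_instance),
    by rw [Over.id_left]; infer_instance⟩

theorem SchemeCat.isProperHom_comp {X Y Z : C.Obj} {f : X.1 ⟶ Y.1} {g : Y.1 ⟶ Z.1}
    (hf : C.IsProperHom f) (hg : C.IsProperHom g) : C.IsProperHom (f ≫ g) :=
  ⟨C.comp_mem f g X.2 Y.2 Z.2 hf.1 hg.1, by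
    have := hf.2
    have := hg.2
    rw [Over.comp_left]; infer_instance⟩

theorem SchemeCat.isProperHom_closed {X Y : C.Obj} {i : Y.1 ⟶ X.1}
    (hi : IsClosedImmersion i.left) : C.IsProperHom i :=
  ⟨C.closed_hom i X.2 hi, inferInstance⟩

theorem isOpenImmersion_id (X : Over B) : IsOpenImmersion (𝟙 X : X ⟶ X).left := by
  rw [Over.id_left]; infer_instance

theorem isOpenImmersion_comp {X Y Z : Over B} {f : X ⟶ Y} {g : Y ⟶ Z}
    (hf : IsOpenImmersion f.left) (hg : IsOpenImmersion g.left) :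
    IsOpenImmersion (f ≫ g).left := by
  rw [Over.comp_left]; infer_instance

/-! ### Homology theories -/

/-- A homology theory on `C` with values in `R`-modules: a sequence of covariant functors on
the category of schemes in `C` and proper morphisms, contravariant for open immersions, with
long exact localization sequences that are functorial for proper morphisms of pairs
`(X', Y') ⟶ (X, Y)` and for open immersions. -/
structure HomologyTheory (C : SchemeCat B) (R : Type v) [Ring R] where
  /-- the group `H_n(X)` -/
  grp : ℤ → C.Obj → ModuleCat.{w} R
  /-- the map `f_*` of a proper morphism -/
  push : ∀ (n : ℤ) {X Y : C.Obj} (f : X.1 ⟶ Y.1), C.IsProperHom f → (grp n X →ₗ[R] grp n Y)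
  push_id : ∀ (n : ℤ) (X : C.Obj), push n (𝟙 X.1) (C.isProperHom_id X) = LinearMap.id
  push_comp : ∀ (n : ℤ) {X Y Z : C.Obj} (f : X.1 ⟶ Y.1) (g : Y.1 ⟶ Z.1)
    (hf : C.IsProperHom f) (hg : C.IsProperHom g),
    push n (f ≫ g) (C.isProperHom_comp hf hg) = push n g hg ∘ₗ push n f hf
  /-- the map `j^*` of an open immersion -/
  pull : ∀ (n : ℤ) {V X : C.Obj} (j : V.1 ⟶ X.1), IsOpenImmersion j.left →
    (grp n X →ₗ[R] grp n V)
  pull_id : ∀ (n : ℤ) (X : C.Obj), pull n (𝟙 X.1) (isOpenImmersion_id X.1) = LinearMap.id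
  pull_comp : ∀ (n : ℤ) {W V X : C.Obj} (k : W.1 ⟶ V.1) (j : V.1 ⟶ X.1)
    (hk : IsOpenImmersion k.left) (hj : IsOpenImmersion j.left),
    pull n (k ≫ j) (isOpenImmersion_comp hk hj) = pull n k hk ∘ₗ pull n j hj
  /-- the connecting morphism `∂ : H_n(V) ⟶ H_{n-1}(Y)` -/
  bdry : ∀ (n : ℤ) {X Y V : C.Obj} (i : Y.1 ⟶ X.1) (j : V.1 ⟶ X.1), IsClosedOpenPair i j →
    (grp n V →ₗ[R] grp (n - 1) Y)
  exact_push_pull : ∀ (n : ℤ) {X Y V : C.Obj} (i : Y.1 ⟶ X.1) (j : V.1 ⟶ X.1)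
    (h : IsClosedOpenPair i j),
    Function.Exact (push n i (C.isProperHom_closed h.closed)) (pull n j h.isOpen)
  exact_pull_bdry : ∀ (n : ℤ) {X Y V : C.Obj} (i : Y.1 ⟶ X.1) (j : V.1 ⟶ X.1)
    (h : IsClosedOpenPair i j), Function.Exact (pull n j h.isOpen) (bdry n i j h)
  exact_bdry_push : ∀ (n : ℤ) {X Y V : C.Obj} (i : Y.1 ⟶ X.1) (j : V.1 ⟶ X.1)
    (h : IsClosedOpenPair i j),
    Function.Exact (bdry n i j h) (push (n - 1) i (C.isProperHom_closed h.closed))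
  /-- `j^* f_* = f_* j^*` for `f : X' ⟶ X` proper, `V ⊆ X` open and `V' = f⁻¹(V)` -/
  pull_push : ∀ (n : ℤ) {X' X V' V : C.Obj} (f : X'.1 ⟶ X.1) (j : V.1 ⟶ X.1)
    (j' : V'.1 ⟶ X'.1) (g : V'.1 ⟶ V.1) (hf : C.IsProperHom f) (hj : IsOpenImmersion j.left)
    (hj' : IsOpenImmersion j'.left) (hg : C.IsProperHom g), g ≫ j = j' ≫ f →
    Set.range j'.left = f.left ⁻¹' Set.range j.left →
    pull n j hj ∘ₗ push n f hf = push n g hg ∘ₗ pull n j' hj'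
  /-- `∂` is compatible with a proper morphism of pairs `f : (X', Y') ⟶ (X, Y)`: with
  `V = X \ Y`, `V' = X' \ Y'` and `W = f⁻¹(V) ⊆ V'`, the composite
  `H_n(V') ⟶ H_n(W) ⟶ H_n(V) ⟶ H_{n-1}(Y)` equals `H_n(V') ⟶ H_{n-1}(Y') ⟶ H_{n-1}(Y)`. -/
  bdry_push : ∀ (n : ℤ) {X' Y' V' X Y V W : C.Obj} (i' : Y'.1 ⟶ X'.1) (j' : V'.1 ⟶ X'.1)
    (i : Y.1 ⟶ X.1) (j : V.1 ⟶ X.1) (f : X'.1 ⟶ X.1) (g : Y'.1 ⟶ Y.1) (k : W.1 ⟶ V'.1)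
    (l : W.1 ⟶ V.1) (h' : IsClosedOpenPair i' j') (h : IsClosedOpenPair i j)
    (_ : C.IsProperHom f) (hg : C.IsProperHom g) (hk : IsOpenImmersion k.left)
    (hl : C.IsProperHom l), g ≫ i = i' ≫ f → l ≫ j = k ≫ j' ≫ f →
    Set.range (k ≫ j').left = f.left ⁻¹' Set.range j.left →
    push (n - 1) g hg ∘ₗ bdry n i' j' h' = bdry n i j h ∘ₗ push n l hl ∘ₗ pull n k hk
  /-- `∂` is compatible with an open immersion `u : X' ⟶ X`, where `Y' = Y ∩ X'`, `V' = V ∩ X'` -/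
  bdry_pull : ∀ (n : ℤ) {X' Y' V' X Y V : C.Obj} (i' : Y'.1 ⟶ X'.1) (j' : V'.1 ⟶ X'.1)
    (i : Y.1 ⟶ X.1) (j : V.1 ⟶ X.1) (u : X'.1 ⟶ X.1) (a : Y'.1 ⟶ Y.1) (b : V'.1 ⟶ V.1)
    (h' : IsClosedOpenPair i' j') (h : IsClosedOpenPair i j) (_ : IsOpenImmersion u.left)
    (ha : IsOpenImmersion a.left) (hb : IsOpenImmersion b.left),
    a ≫ i = i' ≫ u → b ≫ j = j' ≫ u →
    pull (n - 1) a ha ∘ₗ bdry n i j h = bdry n i' j' h' ∘ₗ pull n b hb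

/-! ### Reduced locally closed subschemes -/

/-- A reduced scheme in `C` with an immersion into `X`. -/
structure Piece (X : C.Obj) where
  dom : C.Obj
  ι : dom.1 ⟶ X.1
  reduced : AlgebraicGeometry.IsReduced dom.1.left
  immersion : IsImmersion ι.left

namespace Piece

variable {X Y : C.Obj}

/-- The underlying locally closed subset. -/
def supp (P : Piece X) : Set X.1.left := Set.range P.ι.left

/-- Composition with an immersion. -/
abbrev map (P : Piece Y) (f : Y.1 ⟶ X.1) (hf : IsImmersion f.left) : Piece X where
  dom := P.dom
  ι := P.ι ≫ f
  reduced := P.reduced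
  immersion := by
    have := P.immersion
    rw [Over.comp_left]; infer_instance

theorem supp_map (P : Piece Y) (f : Y.1 ⟶ X.1) (hf : IsImmersion f.left) :
    (P.map f hf).supp = f.left '' P.supp := by
  change Set.range (P.ι ≫ f).left = _
  rw [Over.comp_left, Scheme.Hom.comp_base, TopCat.coe_comp, Set.range_comp]
  rfl

theorem exists_lift (P Q : Piece X) (h : P.supp ⊆ Q.supp) :
    ∃ l : P.dom.1 ⟶ Q.dom.1, l ≫ Q.ι = P.ι := by
  have := P.reduced
  have := Q.immersion
  obtain ⟨l, hl⟩ := exists_lift_of_range_subset P.ι.left Q.ι.left h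
  exact ⟨Over.homMk l (by rw [← Over.w Q.ι, reassoc_of% hl, Over.w]), Over.OverMorphism.ext hl⟩

/-- The inclusion of reduced locally closed subschemes given by an inclusion of subsets. -/
noncomputable def lift (P Q : Piece X) (h : P.supp ⊆ Q.supp) : P.dom.1 ⟶ Q.dom.1 :=
  (exists_lift P Q h).choose

theorem lift_ι (P Q : Piece X) (h : P.supp ⊆ Q.supp) : P.lift Q h ≫ Q.ι = P.ι :=
  (exists_lift P Q h).choose_spec

theorem hom_ext (Q : Piece X) {T : Over B} {a b : T ⟶ Q.dom.1} (h : a ≫ Q.ι = b ≫ Q.ι) :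
    a = b := by
  have := Q.immersion
  refine Over.OverMorphism.ext ((cancel_mono Q.ι.left).1 ?_)
  rw [← Over.comp_left, h, Over.comp_left]

/-- The subset of `P` is closed in the subset of `Q`. -/
def ClosedIn (P Q : Piece X) : Prop := ∃ F : Set X.1.left, IsClosed F ∧ P.supp = Q.supp ∩ F

/-- The subset of `P` is open in the subset of `Q`. -/
def OpenIn (P Q : Piece X) : Prop := ∃ U : Set X.1.left, IsOpen U ∧ P.supp = Q.supp ∩ U

theorem ClosedIn.le {P Q : Piece X} (h : P.ClosedIn Q) : P.supp ⊆ Q.supp := by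
  obtain ⟨F, -, h⟩ := h
  exact h ▸ Set.inter_subset_left

theorem OpenIn.le {P Q : Piece X} (h : P.OpenIn Q) : P.supp ⊆ Q.supp := by
  obtain ⟨F, -, h⟩ := h
  exact h ▸ Set.inter_subset_left

theorem range_lift (P Q : Piece X) (h : P.supp ⊆ Q.supp) :
    Set.range (P.lift Q h).left = Q.ι.left ⁻¹' P.supp := by
  have := Q.immersion
  have e : (P.lift Q h).left ≫ Q.ι.left = P.ι.left := by rw [← Over.comp_left, lift_ι]
  ext y
  constructor
  · rintro ⟨x, rfl⟩
    exact ⟨x, by rw [← e]; simp⟩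
  · rintro ⟨x, hx⟩
    exact ⟨x, Q.ι.left.isEmbedding.injective (by rw [← hx, ← e]; simp)⟩

theorem isClosedImmersion_lift {P Q : Piece X} (h : P.ClosedIn Q) :
    IsClosedImmersion (P.lift Q h.le).left := by
  have := Q.immersion
  have e : (P.lift Q h.le).left ≫ Q.ι.left = P.ι.left := by rw [← Over.comp_left, lift_ι]
  have : IsImmersion ((P.lift Q h.le).left ≫ Q.ι.left) := by rw [e]; exact P.immersion
  obtain ⟨F, hF, hPQ⟩ := h
  exact isClosedImmersion_of_comp _ Q.ι.left hF (by rw [e]; exact hPQ)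

theorem isOpenImmersion_lift {P Q : Piece X} (h : P.OpenIn Q) :
    IsOpenImmersion (P.lift Q h.le).left := by
  have := Q.immersion
  have := Q.reduced
  have e : (P.lift Q h.le).left ≫ Q.ι.left = P.ι.left := by rw [← Over.comp_left, lift_ι]
  have : IsImmersion ((P.lift Q h.le).left ≫ Q.ι.left) := by rw [e]; exact P.immersion
  obtain ⟨F, hF, hPQ⟩ := h
  exact isOpenImmersion_of_comp _ Q.ι.left hF (by rw [e]; exact hPQ)

theorem isClosedOpenPair_lift {Z U Q : Piece X} (hZ : Z.ClosedIn Q) (hU : U.OpenIn Q)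
    (h : U.supp = Q.supp \ Z.supp) : IsClosedOpenPair (Z.lift Q hZ.le) (U.lift Q hU.le) where
  closed := isClosedImmersion_lift hZ
  isOpen := isOpenImmersion_lift hU
  range_eq := by
    rw [range_lift, range_lift, h]
    ext y
    have : Q.ι.left y ∈ Q.supp := ⟨y, rfl⟩
    simp [this]

theorem lift_map (P Q : Piece Y) (f : Y.1 ⟶ X.1) (hf : IsImmersion f.left)
    (h : P.supp ⊆ Q.supp) (h' : (P.map f hf).supp ⊆ (Q.map f hf).supp) :
    (P.map f hf).lift (Q.map f hf) h' = P.lift Q h := by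
  apply (Q.map f hf).hom_ext
  rw [lift_ι]
  change P.ι ≫ f = P.lift Q h ≫ Q.ι ≫ f
  rw [← Category.assoc, lift_ι]

theorem openIn_compl {Z U Q : Piece X} (hZ : Z.ClosedIn Q) (h : U.supp = Q.supp \ Z.supp) :
    U.OpenIn Q := by
  obtain ⟨F, hF, e⟩ := hZ
  refine ⟨Fᶜ, hF.isOpen_compl, ?_⟩
  rw [h, e, Set.sdiff_self_inter, Set.sdiff_eq]

theorem ClosedIn.map {P Q : Piece Y} (h : P.ClosedIn Q) (f : Y.1 ⟶ X.1)
    (hf : IsImmersion f.left) : (P.map f hf).ClosedIn (Q.map f hf) := by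
  obtain ⟨F, hF, e⟩ := h
  obtain ⟨G, hG, rfl⟩ := f.left.isEmbedding.isInducing.isClosed_iff.1 hF
  exact ⟨G, hG, by rw [supp_map, supp_map, e, Set.image_inter_preimage]⟩

theorem OpenIn.map {P Q : Piece Y} (h : P.OpenIn Q) (f : Y.1 ⟶ X.1)
    (hf : IsImmersion f.left) : (P.map f hf).OpenIn (Q.map f hf) := by
  obtain ⟨F, hF, e⟩ := h
  obtain ⟨G, hG, rfl⟩ := f.left.isEmbedding.isInducing.isOpen_iff.1 hF
  exact ⟨G, hG, by rw [supp_map, supp_map, e, Set.image_inter_preimage]⟩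

/-- The reduced subscheme structure on a locally closed subset `S` of `X`: the reduced induced
structure on `S` as a closed subset of the open subscheme of `X` in which it is closed. -/
noncomputable def ofSet (X : C.Obj) (S : Set X.1.left) (hS : IsLocallyClosed S) : Piece X :=
  let U : X.1.left.Opens := ⟨coborder S, hS.isOpen_coborder⟩
  let Z : Closeds U.toScheme := ⟨U.ι ⁻¹' S, isClosed_preimage_val_coborder⟩
  let I := Scheme.IdealSheafData.vanishingIdeal Z
  let V : Over B := Over.mk (U.ι ≫ X.1.hom)
  let j : V ⟶ X.1 := Over.homMk U.ι rfl
  let W : Over B := Over.mk (I.subschemeι ≫ V.hom)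
  let i : W ⟶ V := Over.homMk I.subschemeι rfl
  have hj : IsOpenImmersion j.left := inferInstanceAs (IsOpenImmersion U.ι)
  have hi : IsClosedImmersion i.left := inferInstanceAs (IsClosedImmersion I.subschemeι)
  { dom := ⟨W, C.closed_obj i (C.open_obj j X.2 hj) hi⟩
    ι := i ≫ j
    reduced := isReduced_subscheme_vanishingIdeal Z
    immersion := by rw [Over.comp_left]; infer_instance }

theorem supp_ofSet (X : C.Obj) (S : Set X.1.left) (hS : IsLocallyClosed S) :
    (ofSet X S hS).supp = S := by
  let U : X.1.left.Opens := ⟨coborder S, hS.isOpen_coborder⟩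
  have hSU : S ⊆ U := subset_coborder
  change Set.range (Scheme.IdealSheafData.subschemeι _ ≫ U.ι) = S
  rw [Scheme.Hom.comp_base, TopCat.coe_comp, Set.range_comp,
    Scheme.IdealSheafData.range_subschemeι, Scheme.IdealSheafData.coe_support_vanishingIdeal]
  change U.ι '' (U.ι ⁻¹' S) = S
  rw [Set.image_preimage_eq_inter_range, Scheme.Opens.range_ι]
  exact Set.inter_eq_left.2 hSU

end Piece

/-! ### Dimension -/

/-- A compactification over `B` of an integral (locally closed) subscheme of `X` with generic
point `x`: a dense open immersion of the subscheme into a proper `B`-scheme. -/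
structure PointCompactification (X : Over B) (x : X.left) where
  /-- the integral subscheme, i.e. a nonempty open subscheme of the reduced closure of `x` -/
  sub : Over B
  integral : IsIntegral sub.left
  incl : sub ⟶ X
  immersion : IsImmersion incl.left
  generic : incl.left (genericPoint sub.left) = x
  /-- the proper `B`-scheme -/
  compact : Over B
  proper : IsProper compact.hom
  emb : sub ⟶ compact
  isOpen : IsOpenImmersion emb.left
  dense : DenseRange emb.left

/-- The dimension of the closure of `x` in `X`, i.e. the Krull dimension of any
compactification over `B` of this closure. Any two compactifications over `B` of nonempty open
subschemes of the closure have the same Krull dimension (they are compactifications of a common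
dense open subscheme), so the supremum is over equal terms. -/
noncomputable def closureDim (X : Over B) (x : X.left) : WithBot ℕ∞ :=
  ⨆ K : PointCompactification X x, topologicalKrullDim K.compact.left

/-- The closed subset `Z` of `X` has dimension `≤ p`: the closures of all its points (in
particular its irreducible components) do. -/
def DimLE (X : Over B) (Z : Set X.left) (p : ℤ) : Prop :=
  ∀ x ∈ Z, ∃ n : ℕ, (n : ℤ) ≤ p ∧ closureDim X x ≤ n

theorem closureDim_le_map {X Y : Over B} (f : Y ⟶ X) (hf : IsImmersion f.left) (y : Y.left) :
    closureDim Y y ≤ closureDim X (f.left y) := by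
  refine iSup_le fun K => ?_
  have := K.immersion
  exact le_iSup (fun K : PointCompactification X (f.left y) => topologicalKrullDim K.compact.left)
    { K with
      incl := K.incl ≫ f
      immersion := by rw [Over.comp_left]; infer_instance
      generic := by rw [Over.comp_left, Scheme.Hom.comp_apply, K.generic] }

theorem closureDim_map_le {X Y : Over B} (f : Y ⟶ X) (hf : IsClosedImmersion f.left)
    (y : Y.left) : closureDim X (f.left y) ≤ closureDim Y y := by
  refine iSup_le fun K => ?_
  have := K.immersion
  have := K.integral
  have hr : Set.range K.incl.left ⊆ Set.range f.left := by
    rintro _ ⟨t, rfl⟩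
    have h : genericPoint K.sub.left ⤳ t := genericPoint_specializes t
    have h2 := h.map K.incl.left.continuous
    rw [K.generic] at h2
    exact h2.mem_closed f.left.isClosedEmbedding.isClosed_range ⟨y, rfl⟩
  obtain ⟨l, hl⟩ := exists_lift_of_range_subset K.incl.left f.left hr
  have : IsImmersion (l ≫ f.left) := by rw [hl]; infer_instance
  exact le_iSup (fun K : PointCompactification Y y => topologicalKrullDim K.compact.left)
    { K with
      incl := Over.homMk l (by rw [← Over.w f, reassoc_of% hl, Over.w])
      immersion := IsImmersion.of_comp l f.left
      generic := f.left.isEmbedding.injective (by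
        have h := K.generic
        rw [← hl, Scheme.Hom.comp_apply] at h
        exact h) }

theorem DimLE.image {X Y : Over B} {f : Y ⟶ X} (hf : IsClosedImmersion f.left)
    {Z : Set Y.left} {p : ℤ} (h : DimLE Y Z p) : DimLE X (f.left '' Z) p := by
  rintro _ ⟨y, hy, rfl⟩
  obtain ⟨n, hn, hd⟩ := h y hy
  exact ⟨n, hn, (closureDim_map_le f hf y).trans hd⟩

theorem DimLE.preimage {X V : Over B} {j : V ⟶ X} (hj : IsOpenImmersion j.left)
    {Z : Set X.left} {p : ℤ} (h : DimLE X Z p) : DimLE V (j.left ⁻¹' Z) p := by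
  intro y hy
  obtain ⟨n, hn, hd⟩ := h _ hy
  exact ⟨n, hn, (closureDim_le_map j inferInstance y).trans hd⟩

theorem DimLE.mono {X : Over B} {Z : Set X.left} {p p' : ℤ} (h : DimLE X Z p) (hp : p ≤ p') :
    DimLE X Z p' := fun x hx =>
  let ⟨n, hn, hd⟩ := h x hx
  ⟨n, hn.trans hp, hd⟩

/-- The ordered set `Z_p(X)` of closed subsets of `X` of dimension `≤ p`. -/
abbrev ClosedLE (X : C.Obj) (p : ℤ) : Type u :=
  {Z : Closeds X.1.left // DimLE X.1 Z p}

/-- The ordered set `Z_p/Z_{p-1}(X)` of pairs `Z' ⊆ Z` of closed subsets of `X` with `Z` of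
dimension `≤ p` and `Z'` of dimension `≤ p - 1`. -/
abbrev ClosedPair (X : C.Obj) (p : ℤ) : Type u :=
  {Z : Closeds X.1.left × Closeds X.1.left //
    DimLE X.1 Z.1 p ∧ DimLE X.1 Z.2 (p - 1) ∧ Z.2 ≤ Z.1}

/-- A closed subset with its reduced scheme structure. -/
noncomputable def closedPiece {X : C.Obj} (Z : Closeds X.1.left) : Piece X :=
  Piece.ofSet X Z Z.isClosed.isLocallyClosed

/-- The difference `Z \ Z'` of two closed subsets with its reduced scheme structure. -/
noncomputable def diffPiece {X : C.Obj} (Z Z' : Closeds X.1.left) : Piece X :=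
  Piece.ofSet X (Z \ Z') (Z.isClosed.isLocallyClosed.inter Z'.isClosed.isOpen_compl.isLocallyClosed)

theorem supp_closedPiece {X : C.Obj} (Z : Closeds X.1.left) :
    (closedPiece (C := C) Z).supp = Z := Piece.supp_ofSet ..

theorem supp_diffPiece {X : C.Obj} (Z Z' : Closeds X.1.left) :
    (diffPiece (C := C) Z Z').supp = (Z : Set X.1.left) \ Z' := Piece.supp_ofSet ..

/-! ### Homology of reduced locally closed subschemes -/

namespace HomologyTheory

variable {R : Type v} [Ring R] (H : HomologyTheory.{u, v, w} C R) {X Y V : C.Obj}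

/-- Pushforward along the inclusion of a closed subset. -/
noncomputable def pPush (n : ℤ) (P Q : Piece X) (h : P.ClosedIn Q) :
    H.grp n P.dom →ₗ[R] H.grp n Q.dom :=
  H.push n (P.lift Q h.le) (C.isProperHom_closed (Piece.isClosedImmersion_lift h))

/-- Restriction to an open subset. -/
noncomputable def pPull (n : ℤ) (Q U : Piece X) (h : U.OpenIn Q) :
    H.grp n Q.dom →ₗ[R] H.grp n U.dom :=
  H.pull n (U.lift Q h.le) (Piece.isOpenImmersion_lift h)

/-- The connecting morphism of the localization sequence of `Z` closed in `Q`, `U = Q \ Z`. -/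
noncomputable def pBdry (n : ℤ) (Z U Q : Piece X) (hZ : Z.ClosedIn Q)
    (hU : U.supp = Q.supp \ Z.supp) : H.grp n U.dom →ₗ[R] H.grp (n - 1) Z.dom :=
  H.bdry n (Z.lift Q hZ.le) (U.lift Q (Piece.openIn_compl hZ hU).le)
    (Piece.isClosedOpenPair_lift hZ (Piece.openIn_compl hZ hU) hU)

theorem push_congr (n : ℤ) {X Y : C.Obj} {f g : X.1 ⟶ Y.1} (h : f = g) (hf : C.IsProperHom f) :
    H.push n f hf = H.push n g (h ▸ hf) := by
  subst h; rfl

theorem pull_congr (n : ℤ) {X Y : C.Obj} {f g : X.1 ⟶ Y.1} (h : f = g)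
    (hf : IsOpenImmersion f.left) : H.pull n f hf = H.pull n g (h ▸ hf) := by
  subst h; rfl

theorem pPush_comp (n : ℤ) {P Q S : Piece X} (h : P.ClosedIn Q) (h' : Q.ClosedIn S)
    (h'' : P.ClosedIn S) : H.pPush n Q S h' ∘ₗ H.pPush n P Q h = H.pPush n P S h'' := by
  unfold pPush
  rw [← H.push_comp]
  exact H.push_congr n (S.hom_ext (by simp [Piece.lift_ι])) _

theorem pPull_comp (n : ℤ) {P Q S : Piece X} (h : P.OpenIn Q) (h' : Q.OpenIn S)
    (h'' : P.OpenIn S) : H.pPull n Q P h ∘ₗ H.pPull n S Q h' = H.pPull n S P h'' := by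
  unfold pPull
  rw [← H.pull_comp]
  exact H.pull_congr n (S.hom_ext (by simp [Piece.lift_ι])) _

theorem pPull_pPush (n : ℤ) {P Q U W : Piece X} (hP : P.ClosedIn Q) (hU : U.OpenIn Q)
    (hWU : W.ClosedIn U) (hWP : W.OpenIn P) (h : W.supp = P.supp ∩ U.supp) :
    H.pPull n Q U hU ∘ₗ H.pPush n P Q hP = H.pPush n W U hWU ∘ₗ H.pPull n P W hWP := by
  refine H.pull_push n _ _ _ _ _ _ _ _ (Q.hom_ext (by simp [Piece.lift_ι])) ?_
  rw [Piece.range_lift, Piece.range_lift, ← Set.preimage_comp, h]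
  have e : (P.lift Q hP.le).left ≫ Q.ι.left = P.ι.left := by
    rw [← Over.comp_left, Piece.lift_ι]
  ext y
  have hy : P.ι.left y ∈ P.supp := ⟨y, rfl⟩
  have hz : Q.ι.left ((P.lift Q hP.le).left y) = P.ι.left y := by rw [← e]; simp
  simp [hy, hz]

theorem pBdry_pPush (n : ℤ) {Z' U' Q' Z U Q W : Piece X} (hZ' : Z'.ClosedIn Q')
    (hU' : U'.supp = Q'.supp \ Z'.supp) (hZ : Z.ClosedIn Q) (hU : U.supp = Q.supp \ Z.supp)
    (hQ : Q'.ClosedIn Q) (hZZ : Z'.ClosedIn Z) (hWU' : W.OpenIn U') (hWU : W.ClosedIn U)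
    (hW : W.supp = Q'.supp ∩ U.supp) :
    H.pPush (n - 1) Z' Z hZZ ∘ₗ H.pBdry n Z' U' Q' hZ' hU' =
      H.pBdry n Z U Q hZ hU ∘ₗ H.pPush n W U hWU ∘ₗ H.pPull n U' W hWU' := by
  refine H.bdry_push n _ _ _ _ (Q'.lift Q hQ.le) _ _ _ _ _
    (C.isProperHom_closed (Piece.isClosedImmersion_lift hQ)) _ _ _
    (Q.hom_ext (by simp [Piece.lift_ι])) (Q.hom_ext (by simp [Piece.lift_ι])) ?_
  have e : (Q'.lift Q hQ.le).left ≫ Q.ι.left = Q'.ι.left := by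
    rw [← Over.comp_left, Piece.lift_ι]
  have hWQ' : W.supp ⊆ Q'.supp := hW ▸ Set.inter_subset_left
  rw [show W.lift U' hWU'.le ≫ U'.lift Q' (Piece.openIn_compl hZ' hU').le = W.lift Q' hWQ' from
    Q'.hom_ext (by simp [Piece.lift_ι]), Piece.range_lift, Piece.range_lift, hW]
  ext y
  have hy : Q'.ι.left y ∈ Q'.supp := ⟨y, rfl⟩
  have hz : Q.ι.left ((Q'.lift Q hQ.le).left y) = Q'.ι.left y := by rw [← e]; simp
  simp [hy, hz]

theorem pBdry_pPull (n : ℤ) {Z' U' Q' Z U Q : Piece X} (hZ' : Z'.ClosedIn Q')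
    (hU' : U'.supp = Q'.supp \ Z'.supp) (hZ : Z.ClosedIn Q) (hU : U.supp = Q.supp \ Z.supp)
    (hQ : Q'.OpenIn Q) (hZZ : Z'.OpenIn Z) (hUU : U'.OpenIn U) :
    H.pPull (n - 1) Z Z' hZZ ∘ₗ H.pBdry n Z U Q hZ hU =
      H.pBdry n Z' U' Q' hZ' hU' ∘ₗ H.pPull n U U' hUU :=
  H.bdry_pull n _ _ _ _ (Q'.lift Q hQ.le) _ _ _ _ (Piece.isOpenImmersion_lift hQ) _ _
    (Q.hom_ext (by simp [Piece.lift_ι])) (Q.hom_ext (by simp [Piece.lift_ι]))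

theorem pPush_map (n : ℤ) (P Q : Piece Y) (f : Y.1 ⟶ X.1) (hf : IsImmersion f.left)
    (h : P.ClosedIn Q) :
    H.pPush n (P.map f hf) (Q.map f hf) (h.map f hf) = H.pPush n P Q h :=
  H.push_congr n (Piece.lift_map P Q f hf h.le _) _

theorem pPull_map (n : ℤ) (P Q : Piece Y) (f : Y.1 ⟶ X.1) (hf : IsImmersion f.left)
    (h : P.OpenIn Q) :
    H.pPull n (Q.map f hf) (P.map f hf) (h.map f hf) = H.pPull n Q P h :=
  H.pull_congr n (Piece.lift_map P Q f hf h.le _) _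

theorem pBdry_map (n : ℤ) (Z U Q : Piece Y) (f : Y.1 ⟶ X.1) (hf : IsImmersion f.left)
    (hZ : Z.ClosedIn Q) (hU : U.supp = Q.supp \ Z.supp)
    (hU' : (U.map f hf).supp = (Q.map f hf).supp \ (Z.map f hf).supp) :
    H.pBdry n (Z.map f hf) (U.map f hf) (Q.map f hf) (hZ.map f hf) hU' =
      H.pBdry n Z U Q hZ hU := by
  have h1 := Piece.lift_map Z Q f hf hZ.le (hZ.map f hf).le
  have h2 := Piece.lift_map U Q f hf (Piece.openIn_compl hZ hU).le
    (Piece.openIn_compl (hZ.map f hf) hU').le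
  unfold pBdry
  simp only [h1, h2]

/-! ### The groups `H_n(Z_p(X))` and `H_n(Z_p/Z_{p-1}(X))` -/

theorem closedIn_closedPiece {Z W : Closeds X.1.left} (h : Z ≤ W) :
    (closedPiece Z : Piece X).ClosedIn (closedPiece W) :=
  ⟨Z, Z.isClosed, by
    rw [supp_closedPiece, supp_closedPiece]; exact (Set.inter_eq_right.2 h).symm⟩

theorem openIn_diffPiece (Z Z' : Closeds X.1.left) :
    (diffPiece Z Z' : Piece X).OpenIn (closedPiece Z) :=
  ⟨(Z' : Set X.1.left)ᶜ, Z'.isClosed.isOpen_compl, by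
    rw [supp_closedPiece, supp_diffPiece, Set.sdiff_eq]⟩

theorem diffPiece_eq {Z Z' : Closeds X.1.left} :
    (diffPiece Z Z' : Piece X).supp =
      (closedPiece Z : Piece X).supp \ (closedPiece Z' : Piece X).supp := by
  rw [supp_closedPiece, supp_closedPiece, supp_diffPiece]

theorem openIn_diffPiece_right (Z : Closeds X.1.left) {Z' W' : Closeds X.1.left} (h : Z' ≤ W') :
    (diffPiece Z W' : Piece X).OpenIn (diffPiece Z Z') :=
  ⟨(W' : Set X.1.left)ᶜ, W'.isClosed.isOpen_compl, by
    rw [supp_diffPiece, supp_diffPiece, ← Set.sdiff_eq, Set.sdiff_sdiff, Set.union_eq_right.2 h]⟩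

theorem closedIn_diffPiece_left {Z W : Closeds X.1.left} (h : Z ≤ W) (W' : Closeds X.1.left) :
    (diffPiece Z W' : Piece X).ClosedIn (diffPiece W W') :=
  ⟨Z, Z.isClosed, by
    rw [supp_diffPiece, supp_diffPiece]
    ext x
    have := @h x
    simp only [Set.mem_sdiff, Set.mem_inter_iff, SetLike.mem_coe] at this ⊢
    tauto⟩

/-- The map `H_n(Z) ⟶ H_n(W)` for closed subsets `Z ⊆ W`. -/
noncomputable def closedMap (n : ℤ) (Z W : Closeds X.1.left) (h : Z ≤ W) :
    H.grp n (closedPiece Z : Piece X).dom →ₗ[R] H.grp n (closedPiece W : Piece X).dom :=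
  H.pPush n _ _ (closedIn_closedPiece h)

/-- The map `H_n(Z \ Z') ⟶ H_n(Z \ W') ⟶ H_n(W \ W')` for `(Z, Z') ≤ (W, W')`. -/
noncomputable def diffMap (n : ℤ) (Z W : Closeds X.1.left × Closeds X.1.left) (h : Z ≤ W) :
    H.grp n (diffPiece Z.1 Z.2 : Piece X).dom →ₗ[R] H.grp n (diffPiece W.1 W.2 : Piece X).dom :=
  H.pPush n _ _ (closedIn_diffPiece_left h.1 W.2) ∘ₗ
    H.pPull n _ _ (openIn_diffPiece_right Z.1 h.2)

open Classical in
/-- `H_n(Z_p(X))`, the direct limit of `H_n(Z)` over the closed subsets `Z` of dimension `≤ p`. -/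
abbrev HZ (X : C.Obj) (p n : ℤ) : Type _ :=
  Module.DirectLimit (fun Z : ClosedLE X p => H.grp n (closedPiece Z.1 : Piece X).dom)
    (fun Z W h => H.closedMap n Z.1 W.1 h)

open Classical in
/-- `H_n(Z_p/Z_{p-1}(X))`, the direct limit of `H_n(Z \ Z')` over the pairs `(Z, Z')`. -/
abbrev HZZ (X : C.Obj) (p n : ℤ) : Type _ :=
  Module.DirectLimit
    (fun Z : ClosedPair X p => H.grp n (diffPiece Z.1.1 Z.1.2 : Piece X).dom)
    (fun Z W h => H.diffMap n Z.1 W.1 h)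

variable (X) in
open Classical in
/-- The natural map `H_n(Z_p(X)) ⟶ H_n(Z_{p'}(X))`. -/
noncomputable def incl {p p' : ℤ} (n : ℤ) (h : p ≤ p') : H.HZ X p n →ₗ[R] H.HZ X p' n :=
  Module.DirectLimit.lift R _ _ _
    (fun Z => Module.DirectLimit.of R (ClosedLE X p')
      (fun Z => H.grp n (closedPiece Z.1 : Piece X).dom) (fun Z W h => H.closedMap n Z.1 W.1 h)
      ⟨Z.1, Z.2.mono h⟩)
    (fun Z W hZW _ => Module.DirectLimit.of_f (R := R) (ι := ClosedLE X p')
      (G := fun Z => H.grp n (closedPiece Z.1 : Piece X).dom)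
      (f := fun Z W h => H.closedMap n Z.1 W.1 h)
      (i := ⟨Z.1, Z.2.mono h⟩) (j := ⟨W.1, W.2.mono h⟩) (hij := hZW))

theorem dimLE_empty (X : Over B) (p : ℤ) : DimLE X ((⊥ : Closeds X.left) : Set X.left) p :=
  fun _ hx => hx.elim

variable (X) in
open Classical in
/-- The natural map `π : H_n(Z_p(X)) ⟶ H_n(Z_p/Z_{p-1}(X))`. -/
noncomputable def proj (p n : ℤ) : H.HZ X p n →ₗ[R] H.HZZ X p n :=
  Module.DirectLimit.lift R _ _ _
    (fun Z => Module.DirectLimit.of R (ClosedPair X p)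
      (fun Z => H.grp n (diffPiece Z.1.1 Z.1.2 : Piece X).dom)
      (fun Z W h => H.diffMap n Z.1 W.1 h) ⟨(Z.1, ⊥), Z.2, dimLE_empty _ _, bot_le⟩ ∘ₗ
        H.pPull n _ _ (openIn_diffPiece Z.1 ⊥))
    (fun Z W hZW x => by
      have hZW' : Z.1 ≤ W.1 := hZW
      have e := H.pPull_pPush n (closedIn_closedPiece hZW') (openIn_diffPiece W.1 ⊥)
        (closedIn_diffPiece_left hZW' ⊥) (openIn_diffPiece Z.1 ⊥) (by
          rw [supp_diffPiece, supp_diffPiece, supp_closedPiece]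
          ext x
          have := @hZW' x
          simp only [Set.mem_sdiff, Set.mem_inter_iff, SetLike.mem_coe] at this ⊢
          tauto)
      have e2 := H.pPull_comp n (openIn_diffPiece_right Z.1 (le_refl ⊥))
        (openIn_diffPiece Z.1 ⊥) (openIn_diffPiece Z.1 ⊥)
      have hle : (⟨(Z.1, ⊥), Z.2, dimLE_empty _ _, bot_le⟩ : ClosedPair X p) ≤
        ⟨(W.1, ⊥), W.2, dimLE_empty _ _, bot_le⟩ := ⟨hZW', le_refl _⟩
      rw [LinearMap.comp_apply, LinearMap.comp_apply,
        ← Module.DirectLimit.of_f (hij := hle)]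
      congr 1
      exact (LinearMap.congr_fun e x).trans
        (congrArg (H.pPush n _ _ (closedIn_diffPiece_left hZW' ⊥)) (LinearMap.congr_fun e2.symm x)))

variable (X) in
open Classical in
/-- The connecting map `δ : H_n(Z_p/Z_{p-1}(X)) ⟶ H_{n-1}(Z_{p-1}(X))`. -/
noncomputable def conn (p n : ℤ) : H.HZZ X p n →ₗ[R] H.HZ X (p - 1) (n - 1) :=
  Module.DirectLimit.lift R _ _ _
    (fun Z => Module.DirectLimit.of R (ClosedLE X (p - 1))
      (fun Z => H.grp (n - 1) (closedPiece Z.1 : Piece X).dom)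
      (fun Z W h => H.closedMap (n - 1) Z.1 W.1 h) ⟨Z.1.2, Z.2.2.1⟩ ∘ₗ
        H.pBdry n _ _ _ (closedIn_closedPiece Z.2.2.2) diffPiece_eq)
    (fun Z W hZW x => by
      have hZW' : Z.1 ≤ W.1 := hZW
      have e := H.pBdry_pPush n (closedIn_closedPiece Z.2.2.2) diffPiece_eq
        (closedIn_closedPiece W.2.2.2) diffPiece_eq (closedIn_closedPiece hZW'.1)
        (closedIn_closedPiece hZW'.2) (openIn_diffPiece_right Z.1.1 hZW'.2)
        (closedIn_diffPiece_left hZW'.1 W.1.2) (by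
          rw [supp_diffPiece, supp_diffPiece, supp_closedPiece]
          ext x
          have := @hZW'.1 x
          simp only [Set.mem_sdiff, Set.mem_inter_iff, SetLike.mem_coe] at this ⊢
          tauto)
      have hle : (⟨Z.1.2, Z.2.2.1⟩ : ClosedLE X (p - 1)) ≤ ⟨W.1.2, W.2.2.1⟩ := hZW'.2
      rw [LinearMap.comp_apply, LinearMap.comp_apply,
        ← Module.DirectLimit.of_f (hij := hle)]
      congr 1
      exact (LinearMap.congr_fun e x).symm)

/-! ### Pushforward along a closed immersion and restriction to an open subscheme -/

theorem closedIn_of_eq {P Q : Piece X} (h : P.supp = Q.supp) : P.ClosedIn Q :=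
  ⟨Set.univ, isClosed_univ, by rw [h, Set.inter_univ]⟩

/-- The image of a closed subset under a closed immersion. -/
def image {i : Y.1 ⟶ X.1} (hi : IsClosedImmersion i.left) (Z : Closeds Y.1.left) :
    Closeds X.1.left :=
  ⟨i.left '' Z, i.left.isClosedEmbedding.isClosedMap _ Z.isClosed⟩

/-- The preimage of a closed subset. -/
def preimage (j : V.1 ⟶ X.1) (Z : Closeds X.1.left) : Closeds V.1.left :=
  ⟨j.left ⁻¹' Z, Z.isClosed.preimage j.left.continuous⟩

section push

variable {i : Y.1 ⟶ X.1} (hi : IsClosedImmersion i.left)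

theorem image_mono {Z W : Closeds Y.1.left} (h : Z ≤ W) : image hi Z ≤ image hi W :=
  Set.image_mono h

theorem supp_map_closedPiece (Z : Closeds Y.1.left) :
    ((closedPiece Z : Piece Y).map i inferInstance).supp =
      (closedPiece (image hi Z) : Piece X).supp := by
  rw [Piece.supp_map, supp_closedPiece, supp_closedPiece]; rfl

theorem supp_map_diffPiece (Z Z' : Closeds Y.1.left) :
    ((diffPiece Z Z' : Piece Y).map i inferInstance).supp =
      (diffPiece (image hi Z) (image hi Z') : Piece X).supp := by
  rw [Piece.supp_map, supp_diffPiece, supp_diffPiece]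
  exact Set.image_sdiff i.left.isEmbedding.injective _ _

/-- `H_n(Z) ⟶ H_n(i(Z))` -/
noncomputable def closedPush (n : ℤ) (Z : Closeds Y.1.left) :
    H.grp n (closedPiece Z : Piece Y).dom →ₗ[R]
      H.grp n (closedPiece (image hi Z) : Piece X).dom :=
  H.pPush n ((closedPiece Z : Piece Y).map i inferInstance) (closedPiece (image hi Z))
    (closedIn_of_eq (supp_map_closedPiece hi Z))

/-- `H_n(Z \ Z') ⟶ H_n(i(Z) \ i(Z'))` -/
noncomputable def diffPush (n : ℤ) (Z Z' : Closeds Y.1.left) :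
    H.grp n (diffPiece Z Z' : Piece Y).dom →ₗ[R]
      H.grp n (diffPiece (image hi Z) (image hi Z') : Piece X).dom :=
  H.pPush n ((diffPiece Z Z' : Piece Y).map i inferInstance) (diffPiece (image hi Z) (image hi Z'))
    (closedIn_of_eq (supp_map_diffPiece hi Z Z'))

theorem closedPush_closedMap (n : ℤ) {Z W : Closeds Y.1.left} (h : Z ≤ W) :
    H.closedPush hi n W ∘ₗ H.closedMap n Z W h =
      H.closedMap n _ _ (image_mono hi h) ∘ₗ H.closedPush hi n Z := by
  have h1 := (closedIn_closedPiece h).map i inferInstance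
  have h2 := closedIn_of_eq (supp_map_closedPiece hi W)
  have h3 := closedIn_of_eq (supp_map_closedPiece hi Z)
  have h4 := closedIn_closedPiece (image_mono hi h)
  have h5 : ((closedPiece Z : Piece Y).map i inferInstance).ClosedIn
      (closedPiece (image hi W)) := by
    obtain ⟨F, hF, e⟩ := h1
    exact ⟨F, hF, by rw [e, supp_map_closedPiece hi W]⟩
  have e1 := H.pPush_comp n h1 h2 h5
  have e2 := H.pPush_comp n h3 h4 h5
  rw [H.pPush_map n _ _ _ _ (closedIn_closedPiece h)] at e1
  exact e1.trans e2.symm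

theorem diffPush_diffMap (n : ℤ) {Z W : Closeds Y.1.left × Closeds Y.1.left} (h : Z ≤ W) :
    H.diffPush hi n W.1 W.2 ∘ₗ H.diffMap n Z W h =
      H.diffMap n (image hi Z.1, image hi Z.2) (image hi W.1, image hi W.2)
        ⟨image_mono hi h.1, image_mono hi h.2⟩ ∘ₗ H.diffPush hi n Z.1 Z.2 := by
  have h1 := (closedIn_diffPiece_left h.1 W.2).map i inferInstance
  have h2 := closedIn_of_eq (supp_map_diffPiece hi W.1 W.2)
  have h3 := closedIn_of_eq (supp_map_diffPiece hi Z.1 W.2)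
  have h4 := closedIn_diffPiece_left (image_mono hi h.1) (image hi W.2)
  have h5 : ((diffPiece Z.1 W.2 : Piece Y).map i inferInstance).ClosedIn
      (diffPiece (image hi W.1) (image hi W.2)) := by
    obtain ⟨F, hF, e⟩ := h1
    exact ⟨F, hF, by rw [e, supp_map_diffPiece hi W.1 W.2]⟩
  have e1 := H.pPush_comp n h1 h2 h5
  have e2 := H.pPush_comp n h3 h4 h5
  rw [H.pPush_map n _ _ _ _ (closedIn_diffPiece_left h.1 W.2)] at e1
  have h6 := (openIn_diffPiece_right Z.1 h.2).map i inferInstance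
  have h7 := openIn_diffPiece_right (image hi Z.1) (image_mono hi h.2)
  have e3 := H.pPull_pPush n (closedIn_of_eq (supp_map_diffPiece hi Z.1 Z.2)) h7 h3 h6 (by
    rw [← supp_map_diffPiece hi]
    exact (Set.inter_eq_right.2 h6.le).symm)
  rw [H.pPull_map n _ _ _ _ (openIn_diffPiece_right Z.1 h.2)] at e3
  refine LinearMap.ext fun x => ?_
  let y := H.pPull n _ _ (openIn_diffPiece_right Z.1 h.2) x
  exact (LinearMap.congr_fun e1 y).trans ((LinearMap.congr_fun e2 y).symm.trans
    (congrArg (H.pPush n _ _ h4) (LinearMap.congr_fun e3 x).symm))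

open Classical in
/-- `i_* : H_n(Z_p(Y)) ⟶ H_n(Z_p(X))` -/
noncomputable def pushHZ (p n : ℤ) : H.HZ Y p n →ₗ[R] H.HZ X p n :=
  Module.DirectLimit.lift R _ _ _
    (fun Z => Module.DirectLimit.of R (ClosedLE X p)
      (fun Z => H.grp n (closedPiece Z.1 : Piece X).dom) (fun Z W h => H.closedMap n Z.1 W.1 h)
      ⟨image hi Z.1, Z.2.image hi⟩ ∘ₗ H.closedPush hi n Z.1)
    (fun Z W hZW x => by
      have hle : (⟨image hi Z.1, Z.2.image hi⟩ : ClosedLE X p) ≤ ⟨image hi W.1, W.2.image hi⟩ :=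
        image_mono hi hZW
      rw [LinearMap.comp_apply, LinearMap.comp_apply,
        ← Module.DirectLimit.of_f (hij := hle)]
      congr 1
      exact LinearMap.congr_fun (H.closedPush_closedMap hi n hZW) x)

open Classical in
/-- `i_* : H_n(Z_p/Z_{p-1}(Y)) ⟶ H_n(Z_p/Z_{p-1}(X))` -/
noncomputable def pushHZZ (p n : ℤ) : H.HZZ Y p n →ₗ[R] H.HZZ X p n :=
  Module.DirectLimit.lift R _ _ _
    (fun Z => Module.DirectLimit.of R (ClosedPair X p)
      (fun Z => H.grp n (diffPiece Z.1.1 Z.1.2 : Piece X).dom)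
      (fun Z W h => H.diffMap n Z.1 W.1 h)
      ⟨(image hi Z.1.1, image hi Z.1.2), Z.2.1.image hi, Z.2.2.1.image hi,
        image_mono hi Z.2.2.2⟩ ∘ₗ H.diffPush hi n Z.1.1 Z.1.2)
    (fun Z W hZW x => by
      have hle : (⟨(image hi Z.1.1, image hi Z.1.2), Z.2.1.image hi, Z.2.2.1.image hi,
          image_mono hi Z.2.2.2⟩ : ClosedPair X p) ≤
          ⟨(image hi W.1.1, image hi W.1.2), W.2.1.image hi, W.2.2.1.image hi,
            image_mono hi W.2.2.2⟩ :=
        ⟨image_mono hi hZW.1, image_mono hi hZW.2⟩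
      rw [LinearMap.comp_apply, LinearMap.comp_apply,
        ← Module.DirectLimit.of_f (hij := hle)]
      congr 1
      exact LinearMap.congr_fun (H.diffPush_diffMap hi n hZW) x)

theorem pushHZ_incl {p p' : ℤ} (n : ℤ) (h : p ≤ p') :
    H.pushHZ hi p' n ∘ₗ H.incl Y n h = H.incl X n h ∘ₗ H.pushHZ hi p n := by
  classical
  refine Module.DirectLimit.hom_ext fun Z => LinearMap.ext fun x => ?_
  simp [pushHZ, incl]

theorem pushHZZ_proj (p n : ℤ) :
    H.pushHZZ hi p n ∘ₗ H.proj Y p n = H.proj X p n ∘ₗ H.pushHZ hi p n := by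
  classical
  refine Module.DirectLimit.hom_ext fun Z => LinearMap.ext fun x => ?_
  simp only [pushHZZ, proj, pushHZ, LinearMap.comp_apply, Module.DirectLimit.lift_of]
  have hb : image hi (⊥ : Closeds Y.1.left) = ⊥ := SetLike.coe_injective (Set.image_empty _)
  have key : ∀ (T : Closeds X.1.left) (hT : image hi (⊥ : Closeds Y.1.left) = T)
      (h1 : DimLE X.1 T (p - 1)) (h2 : T ≤ image hi Z.1),
      Module.DirectLimit.of R (ClosedPair X p)
        (fun Z => H.grp n (diffPiece Z.1.1 Z.1.2 : Piece X).dom)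
        (fun Z W h => H.diffMap n Z.1 W.1 h)
        ⟨(image hi Z.1, image hi ⊥), Z.2.image hi, (dimLE_empty _ _).image hi,
          image_mono hi bot_le⟩ (H.diffPush hi n Z.1 ⊥ (H.pPull n _ _ (openIn_diffPiece Z.1 ⊥) x)) =
      Module.DirectLimit.of R (ClosedPair X p)
        (fun Z => H.grp n (diffPiece Z.1.1 Z.1.2 : Piece X).dom)
        (fun Z W h => H.diffMap n Z.1 W.1 h) ⟨(image hi Z.1, T), Z.2.image hi, h1, h2⟩
        (H.pPull n _ _ (openIn_diffPiece (image hi Z.1) T) (H.closedPush hi n Z.1 x)) := by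
    rintro T rfl h1 h2
    congr 1
    have h6 := (openIn_diffPiece Z.1 ⊥).map i inferInstance
    have e3 := H.pPull_pPush n (closedIn_of_eq (supp_map_closedPiece hi Z.1))
      (openIn_diffPiece (image hi Z.1) (image hi ⊥))
      (closedIn_of_eq (supp_map_diffPiece hi Z.1 ⊥)) h6 (by
        rw [← supp_map_diffPiece hi]
        exact (Set.inter_eq_right.2 h6.le).symm)
    rw [H.pPull_map n _ _ _ _ (openIn_diffPiece Z.1 ⊥)] at e3
    exact (LinearMap.congr_fun e3 x).symm
  exact key ⊥ hb (dimLE_empty _ _) bot_le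

theorem pushHZ_conn (p n : ℤ) :
    H.pushHZ hi (p - 1) (n - 1) ∘ₗ H.conn Y p n = H.conn X p n ∘ₗ H.pushHZZ hi p n := by
  classical
  refine Module.DirectLimit.hom_ext fun Z => LinearMap.ext fun x => ?_
  simp only [pushHZZ, conn, pushHZ, LinearMap.comp_apply, Module.DirectLimit.lift_of]
  congr 1
  have hU' : ((diffPiece Z.1.1 Z.1.2 : Piece Y).map i inferInstance).supp =
      ((closedPiece Z.1.1 : Piece Y).map i inferInstance).supp \
        ((closedPiece Z.1.2 : Piece Y).map i inferInstance).supp := by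
    rw [supp_map_diffPiece hi, supp_map_closedPiece hi, supp_map_closedPiece hi, diffPiece_eq]
  have e := H.pBdry_pPush n ((closedIn_closedPiece Z.2.2.2).map i inferInstance) hU'
    (closedIn_closedPiece (image_mono hi Z.2.2.2)) diffPiece_eq
    (closedIn_of_eq (supp_map_closedPiece hi Z.1.1))
    (closedIn_of_eq (supp_map_closedPiece hi Z.1.2))
    (W := (diffPiece Z.1.1 Z.1.2 : Piece Y).map i inferInstance)
    ⟨Set.univ, isOpen_univ, by rw [Set.inter_univ]⟩
    (closedIn_of_eq (supp_map_diffPiece hi Z.1.1 Z.1.2)) (by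
      rw [supp_map_closedPiece hi, supp_map_diffPiece hi, diffPiece_eq]
      exact (Set.inter_eq_right.2 Set.sdiff_subset).symm)
  rw [pBdry_map _ _ _ _ _ _ _ _ diffPiece_eq] at e
  have hid : ∀ (P : Piece X) (h : P.OpenIn P) (y), H.pPull n P P h y = y := by
    intro P h y
    have : P.lift P h.le = 𝟙 _ := P.hom_ext (by rw [Piece.lift_ι, Category.id_comp])
    exact LinearMap.congr_fun ((H.pull_congr n this _).trans (H.pull_id n P.dom)) y
  exact (LinearMap.congr_fun e x).trans (congrArg (fun y => H.pBdry n _ _ _ _ _ (H.pPush n _ _ _ y))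
    (hid ((diffPiece Z.1.1 Z.1.2 : Piece Y).map i inferInstance)
      ⟨Set.univ, isOpen_univ, by rw [Set.inter_univ]⟩ x))

end push

section pull

variable {j : V.1 ⟶ X.1}

theorem preimage_mono {Z W : Closeds X.1.left} (h : Z ≤ W) : preimage j Z ≤ preimage j W :=
  Set.preimage_mono (f := j.left) (s := (Z : Set X.1.left)) (t := W) h

theorem supp_map_closedPiece_preimage (hj : IsOpenImmersion j.left) (Z : Closeds X.1.left) :
    ((closedPiece (preimage j Z) : Piece V).map j inferInstance).supp =
      (closedPiece Z : Piece X).supp ∩ Set.range j.left := by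
  rw [Piece.supp_map, supp_closedPiece, supp_closedPiece]
  exact Set.image_preimage_eq_inter_range

theorem supp_map_diffPiece_preimage (hj : IsOpenImmersion j.left) (Z Z' : Closeds X.1.left) :
    ((diffPiece (preimage j Z) (preimage j Z') : Piece V).map j inferInstance).supp =
      (diffPiece Z Z' : Piece X).supp ∩ Set.range j.left := by
  rw [Piece.supp_map, supp_diffPiece, supp_diffPiece]
  exact Set.image_preimage_eq_inter_range (t := (Z : Set X.1.left) \ Z')

variable (hj : IsOpenImmersion j.left)

theorem openIn_closedPiece_preimage (Z : Closeds X.1.left) :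
    ((closedPiece (preimage j Z) : Piece V).map j inferInstance).OpenIn (closedPiece Z) :=
  ⟨_, j.left.isOpenEmbedding.isOpen_range, supp_map_closedPiece_preimage hj Z⟩

theorem openIn_diffPiece_preimage (Z Z' : Closeds X.1.left) :
    ((diffPiece (preimage j Z) (preimage j Z') : Piece V).map j inferInstance).OpenIn
      (diffPiece Z Z') :=
  ⟨_, j.left.isOpenEmbedding.isOpen_range, supp_map_diffPiece_preimage hj Z Z'⟩

/-- `H_n(Z) ⟶ H_n(Z ∩ V)` -/
noncomputable def closedPull (n : ℤ) (Z : Closeds X.1.left) :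
    H.grp n (closedPiece Z : Piece X).dom →ₗ[R]
      H.grp n (closedPiece (preimage j Z) : Piece V).dom :=
  H.pPull n (closedPiece Z) ((closedPiece (preimage j Z) : Piece V).map j inferInstance)
    (openIn_closedPiece_preimage hj Z)

/-- `H_n(Z \ Z') ⟶ H_n((Z \ Z') ∩ V)` -/
noncomputable def diffPull (n : ℤ) (Z Z' : Closeds X.1.left) :
    H.grp n (diffPiece Z Z' : Piece X).dom →ₗ[R]
      H.grp n (diffPiece (preimage j Z) (preimage j Z') : Piece V).dom :=
  H.pPull n (diffPiece Z Z')
    ((diffPiece (preimage j Z) (preimage j Z') : Piece V).map j inferInstance)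
    (openIn_diffPiece_preimage hj Z Z')

theorem closedPull_closedMap (n : ℤ) {Z W : Closeds X.1.left} (h : Z ≤ W) :
    H.closedPull hj n W ∘ₗ H.closedMap n Z W h =
      H.closedMap n _ _ (preimage_mono h) ∘ₗ H.closedPull hj n Z := by
  have e := H.pPull_pPush n (closedIn_closedPiece h) (openIn_closedPiece_preimage hj W)
    ((closedIn_closedPiece (preimage_mono (j := j) h)).map j inferInstance)
    (openIn_closedPiece_preimage hj Z) (by
      rw [supp_map_closedPiece_preimage hj, supp_map_closedPiece_preimage hj, ← Set.inter_assoc,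
        Set.inter_eq_left.2 (closedIn_closedPiece h).le])
  rw [H.pPush_map n _ _ _ _ (closedIn_closedPiece (preimage_mono h))] at e
  exact e

theorem diffPull_diffMap (n : ℤ) {Z W : Closeds X.1.left × Closeds X.1.left} (h : Z ≤ W) :
    H.diffPull hj n W.1 W.2 ∘ₗ H.diffMap n Z W h =
      H.diffMap n (preimage j Z.1, preimage j Z.2) (preimage j W.1, preimage j W.2)
        ⟨preimage_mono h.1, preimage_mono h.2⟩ ∘ₗ H.diffPull hj n Z.1 Z.2 := by
  have h1 := (closedIn_diffPiece_left (preimage_mono (j := j) h.1) (preimage j W.2)).map j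
    inferInstance
  have h2 := (openIn_diffPiece_right (preimage j Z.1) (preimage_mono (j := j) h.2)).map j
    inferInstance
  have e := H.pPull_pPush n (closedIn_diffPiece_left h.1 W.2) (openIn_diffPiece_preimage hj W.1 W.2)
    h1 (openIn_diffPiece_preimage hj Z.1 W.2) (by
      rw [supp_map_diffPiece_preimage hj, supp_map_diffPiece_preimage hj, ← Set.inter_assoc,
        Set.inter_eq_left.2 (closedIn_diffPiece_left h.1 W.2).le])
  have h3 : ((diffPiece (preimage j Z.1) (preimage j W.2) : Piece V).map j inferInstance).OpenIn
      (diffPiece Z.1 Z.2) := by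
    obtain ⟨F, hF, e1⟩ := openIn_diffPiece_preimage hj Z.1 W.2
    obtain ⟨G, hG, e2⟩ := openIn_diffPiece_right Z.1 h.2
    exact ⟨G ∩ F, hG.inter hF, by rw [e1, e2, Set.inter_assoc]⟩
  have e1 := H.pPull_comp n (openIn_diffPiece_preimage hj Z.1 W.2)
    (openIn_diffPiece_right Z.1 h.2) h3
  have e2 := H.pPull_comp n h2 (openIn_diffPiece_preimage hj Z.1 Z.2) h3
  rw [H.pPush_map n _ _ _ _ (closedIn_diffPiece_left (preimage_mono h.1) (preimage j W.2))] at e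
  rw [H.pPull_map n _ _ _ _ (openIn_diffPiece_right (preimage j Z.1) (preimage_mono h.2))] at e2
  refine LinearMap.ext fun x => ?_
  let y := H.pPull n _ _ (openIn_diffPiece_right Z.1 h.2) x
  have s1 := LinearMap.congr_fun e y
  have s2 := LinearMap.congr_fun e1 x
  have s3 := LinearMap.congr_fun e2 x
  refine s1.trans ?_
  refine (congrArg (H.pPush n (diffPiece (preimage j Z.1) (preimage j W.2))
    (diffPiece (preimage j W.1) (preimage j W.2)) (closedIn_diffPiece_left
    (preimage_mono h.1) (preimage j W.2))) (s2.trans s3.symm))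

open Classical in
/-- `j^* : H_n(Z_p(X)) ⟶ H_n(Z_p(V))` -/
noncomputable def pullHZ (p n : ℤ) : H.HZ X p n →ₗ[R] H.HZ V p n :=
  Module.DirectLimit.lift R _ _ _
    (fun Z => Module.DirectLimit.of R (ClosedLE V p)
      (fun Z => H.grp n (closedPiece Z.1 : Piece V).dom) (fun Z W h => H.closedMap n Z.1 W.1 h)
      ⟨preimage j Z.1, Z.2.preimage hj⟩ ∘ₗ H.closedPull hj n Z.1)
    (fun Z W hZW x => by
      have hle : (⟨preimage j Z.1, Z.2.preimage hj⟩ : ClosedLE V p) ≤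
        ⟨preimage j W.1, W.2.preimage hj⟩ := preimage_mono hZW
      rw [LinearMap.comp_apply, LinearMap.comp_apply,
        ← Module.DirectLimit.of_f (hij := hle)]
      congr 1
      exact LinearMap.congr_fun (H.closedPull_closedMap hj n hZW) x)

open Classical in
/-- `j^* : H_n(Z_p/Z_{p-1}(X)) ⟶ H_n(Z_p/Z_{p-1}(V))` -/
noncomputable def pullHZZ (p n : ℤ) : H.HZZ X p n →ₗ[R] H.HZZ V p n :=
  Module.DirectLimit.lift R _ _ _
    (fun Z => Module.DirectLimit.of R (ClosedPair V p)
      (fun Z => H.grp n (diffPiece Z.1.1 Z.1.2 : Piece V).dom)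
      (fun Z W h => H.diffMap n Z.1 W.1 h)
      ⟨(preimage j Z.1.1, preimage j Z.1.2), Z.2.1.preimage hj, Z.2.2.1.preimage hj,
        preimage_mono Z.2.2.2⟩ ∘ₗ H.diffPull hj n Z.1.1 Z.1.2)
    (fun Z W hZW x => by
      have hle : (⟨(preimage j Z.1.1, preimage j Z.1.2), Z.2.1.preimage hj, Z.2.2.1.preimage hj,
          preimage_mono Z.2.2.2⟩ : ClosedPair V p) ≤
          ⟨(preimage j W.1.1, preimage j W.1.2), W.2.1.preimage hj, W.2.2.1.preimage hj,
            preimage_mono W.2.2.2⟩ :=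
        ⟨preimage_mono hZW.1, preimage_mono hZW.2⟩
      rw [LinearMap.comp_apply, LinearMap.comp_apply,
        ← Module.DirectLimit.of_f (hij := hle)]
      congr 1
      exact LinearMap.congr_fun (H.diffPull_diffMap hj n hZW) x)

theorem pullHZ_incl {p p' : ℤ} (n : ℤ) (h : p ≤ p') :
    H.pullHZ hj p' n ∘ₗ H.incl X n h = H.incl V n h ∘ₗ H.pullHZ hj p n := by
  classical
  refine Module.DirectLimit.hom_ext fun Z => LinearMap.ext fun x => ?_
  simp [pullHZ, incl]

theorem pullHZZ_proj (p n : ℤ) :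
    H.pullHZZ hj p n ∘ₗ H.proj X p n = H.proj V p n ∘ₗ H.pullHZ hj p n := by
  classical
  refine Module.DirectLimit.hom_ext fun Z => LinearMap.ext fun x => ?_
  simp only [pullHZZ, proj, pullHZ, LinearMap.comp_apply, Module.DirectLimit.lift_of]
  have h1 := (openIn_diffPiece (preimage j Z.1) (preimage j ⊥)).map j inferInstance
  have h3 : ((diffPiece (preimage j Z.1) (preimage j ⊥) : Piece V).map j inferInstance).OpenIn
      (closedPiece Z.1) := by
    obtain ⟨F, hF, e1⟩ := openIn_diffPiece_preimage hj Z.1 ⊥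
    obtain ⟨G, hG, e2⟩ := openIn_diffPiece Z.1 ⊥
    exact ⟨G ∩ F, hG.inter hF, by rw [e1, e2, Set.inter_assoc]⟩
  have e1 := H.pPull_comp n h1 (openIn_closedPiece_preimage hj Z.1) h3
  have e2 := H.pPull_comp n (openIn_diffPiece_preimage hj Z.1 ⊥) (openIn_diffPiece Z.1 ⊥) h3
  rw [H.pPull_map n _ _ _ _ (openIn_diffPiece (preimage j Z.1) (preimage j ⊥))] at e1
  exact congrArg (Module.DirectLimit.of R (ClosedPair V p)
        (fun Z => H.grp n (diffPiece Z.1.1 Z.1.2 : Piece V).dom)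
        (fun Z W h => H.diffMap n Z.1 W.1 h)
        ⟨(preimage j Z.1, ⊥), Z.2.preimage hj, dimLE_empty _ _, bot_le⟩)
        (LinearMap.congr_fun (e2.trans e1.symm) x)

theorem pullHZ_conn (p n : ℤ) :
    H.pullHZ hj (p - 1) (n - 1) ∘ₗ H.conn X p n = H.conn V p n ∘ₗ H.pullHZZ hj p n := by
  classical
  refine Module.DirectLimit.hom_ext fun Z => LinearMap.ext fun x => ?_
  simp only [pullHZZ, conn, pullHZ, LinearMap.comp_apply, Module.DirectLimit.lift_of]
  congr 1
  have hU' : ((diffPiece (preimage j Z.1.1) (preimage j Z.1.2) : Piece V).map j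
      inferInstance).supp =
      ((closedPiece (preimage j Z.1.1) : Piece V).map j inferInstance).supp \
        ((closedPiece (preimage j Z.1.2) : Piece V).map j inferInstance).supp := by
    rw [supp_map_diffPiece_preimage hj, supp_map_closedPiece_preimage hj,
      supp_map_closedPiece_preimage hj, diffPiece_eq]
    ext y
    simp only [Set.mem_sdiff, Set.mem_inter_iff]
    tauto
  have e := H.pBdry_pPull n
    ((closedIn_closedPiece (preimage_mono (j := j) Z.2.2.2)).map j inferInstance) hU'
    (closedIn_closedPiece Z.2.2.2) diffPiece_eq (openIn_closedPiece_preimage hj Z.1.1)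
    (openIn_closedPiece_preimage hj Z.1.2) (openIn_diffPiece_preimage hj Z.1.1 Z.1.2)
  rw [pBdry_map _ _ _ _ _ _ _ _ diffPiece_eq] at e
  exact LinearMap.congr_fun e x

end pull

/-! ### The niveau spectral sequence -/

variable (X)

/-- `E^1_{p,q}(X) = H_{p+q}(Z_p/Z_{p-1}(X))` -/
abbrev E1 (p q : ℤ) : Type _ := H.HZZ X p (p + q)

/-- `B^r_{p,q}(X) ⊆ E^1_{p,q}(X)`: the image under `π` of the kernel of
`H_{p+q}(Z_p(X)) ⟶ H_{p+q}(Z_{p+r}(X))`. -/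
noncomputable def Bsub (p q : ℤ) (r : ℕ) : Submodule R (H.E1 X p q) :=
  (LinearMap.ker (H.incl X (p + q) (show p ≤ p + r by lia))).map (H.proj X p (p + q))

/-- `Z^r_{p,q}(X) ⊆ E^1_{p,q}(X)`: the preimage under `δ` of the image of
`H_{p+q-1}(Z_{p-1-r}(X)) ⟶ H_{p+q-1}(Z_{p-1}(X))`. -/
noncomputable def Zsub (p q : ℤ) (r : ℕ) : Submodule R (H.E1 X p q) :=
  (LinearMap.range (H.incl X (p + q - 1) (show p - 1 - r ≤ p - 1 by lia))).comap
    (H.conn X p (p + q))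

/-- `Z^∞_{p,q}(X) = ⋂ r, Z^r_{p,q}(X)` -/
noncomputable def Zinf (p q : ℤ) : Submodule R (H.E1 X p q) := ⨅ r : ℕ, H.Zsub X p q r

/-- `Z^∞_{p,q}(X) / B^r_{p,q}(X)` -/
abbrev ZinfB (p q : ℤ) (r : ℕ) : Type _ :=
  H.Zinf X p q ⧸ (H.Bsub X p q r).submoduleOf (H.Zinf X p q)

variable {X}

/-- A map `E^1_{p,q}(X) ⟶ E^1_{p,q}(Y)` respecting `Z^∞` and `B^r` induces a map on the
quotients `Z^∞/B^r`. -/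
noncomputable def mapZinfB {p q : ℤ} {r : ℕ} (f : H.E1 X p q →ₗ[R] H.E1 Y p q)
    (hZ : H.Zinf X p q ≤ (H.Zinf Y p q).comap f) (hB : H.Bsub X p q r ≤ (H.Bsub Y p q r).comap f) :
    H.ZinfB X p q r →ₗ[R] H.ZinfB Y p q r :=
  Submodule.mapQ _ _ (f.restrict hZ) (fun _ hx => hB hx)

theorem Bsub_le {p q : ℤ} {r : ℕ} (f : H.E1 X p q →ₗ[R] H.E1 Y p q)
    (g : ∀ p' : ℤ, H.HZ X p' (p + q) →ₗ[R] H.HZ Y p' (p + q))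
    (hg : ∀ (p' p'' : ℤ) (h : p' ≤ p''),
      g p'' ∘ₗ H.incl X (p + q) h = H.incl Y (p + q) h ∘ₗ g p')
    (hf : f ∘ₗ H.proj X p (p + q) = H.proj Y p (p + q) ∘ₗ g p) :
    H.Bsub X p q r ≤ (H.Bsub Y p q r).comap f := by
  rintro _ ⟨x, hx, rfl⟩
  refine ⟨g p x, ?_, (LinearMap.congr_fun hf x).symm⟩
  rw [SetLike.mem_coe, LinearMap.mem_ker] at hx ⊢
  have := LinearMap.congr_fun (hg p (p + r) (by lia)) x
  rw [LinearMap.comp_apply, LinearMap.comp_apply, hx, map_zero] at this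
  exact this.symm

theorem Zinf_le {p q : ℤ} (f : H.E1 X p q →ₗ[R] H.E1 Y p q)
    (g : ∀ p' : ℤ, H.HZ X p' (p + q - 1) →ₗ[R] H.HZ Y p' (p + q - 1))
    (hg : ∀ (p' p'' : ℤ) (h : p' ≤ p''),
      g p'' ∘ₗ H.incl X (p + q - 1) h = H.incl Y (p + q - 1) h ∘ₗ g p')
    (hf : g (p - 1) ∘ₗ H.conn X p (p + q) = H.conn Y p (p + q) ∘ₗ f) :
    H.Zinf X p q ≤ (H.Zinf Y p q).comap f := by
  intro x hx
  rw [Submodule.mem_comap, Zinf, Submodule.mem_iInf]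
  intro r
  rw [Zinf, Submodule.mem_iInf] at hx
  obtain ⟨y, hy⟩ := hx r
  refine ⟨g _ y, ?_⟩
  have := LinearMap.congr_fun (hg (p - 1 - r) (p - 1) (by lia)) y
  rw [LinearMap.comp_apply, LinearMap.comp_apply] at this
  rw [← this, hy]
  exact LinearMap.congr_fun hf x

/-- `i_* : Z^∞_{p,q}(Y)/B^r_{p,q}(Y) ⟶ Z^∞_{p,q}(X)/B^r_{p,q}(X)` -/
noncomputable def pushZinfB {i : Y.1 ⟶ X.1} (hi : IsClosedImmersion i.left) (p q : ℤ) (r : ℕ) :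
    H.ZinfB Y p q r →ₗ[R] H.ZinfB X p q r :=
  H.mapZinfB (H.pushHZZ hi p (p + q))
    (H.Zinf_le _ (fun p' => H.pushHZ hi p' _) (fun _ _ h => H.pushHZ_incl hi _ h)
      (H.pushHZ_conn hi _ _))
    (H.Bsub_le _ (fun p' => H.pushHZ hi p' _) (fun _ _ h => H.pushHZ_incl hi _ h)
      (H.pushHZZ_proj hi _ _))

/-- `j^* : Z^∞_{p,q}(X)/B^r_{p,q}(X) ⟶ Z^∞_{p,q}(V)/B^r_{p,q}(V)` -/
noncomputable def pullZinfB {j : V.1 ⟶ X.1} (hj : IsOpenImmersion j.left) (p q : ℤ) (r : ℕ) :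
    H.ZinfB X p q r →ₗ[R] H.ZinfB V p q r :=
  H.mapZinfB (H.pullHZZ hj p (p + q))
    (H.Zinf_le _ (fun p' => H.pullHZ hj p' _) (fun _ _ h => H.pullHZ_incl hj _ h)
      (H.pullHZ_conn hj _ _))
    (H.Bsub_le _ (fun p' => H.pullHZ hj p' _) (fun _ _ h => H.pullHZ_incl hj _ h)
      (H.pullHZZ_proj hj _ _))

end HomologyTheory

end Niveau

/-!
# The fundamental lemma on the niveau spectral sequence

Put `n = p + q` and `m = p + q + e`. Since there are no supports of negative dimension, `Z^∞_{s,t}`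
is the image of `π`, and for `s + t = n` the quotient `Z^∞_{s,t}/B^{m-s}_{s,t}` is the graded piece
of degree `s` of the filtration of `H_n(Z_m)` by the images of the groups `H_n(Z_s)`
(`proj_mem_Bsub_iff`). All groups in the theorem are graded pieces for the same `n` and `m`: the
hypothesis on `V` says that the filtration of `H_n(Z_m(V))` vanishes in degrees `< p`, the one on
`Y` that the filtration of `H_n(Z_m(Y))` is constant in degrees from `p` to `m - 1`.

If a class `α` of `H_n(Z_p(X))` restricts to zero in the graded piece for `V`, its restriction comes
from `H_n(Z_{p-1}(V))`, so it is zero in `H_n(Z_m(V))`, that is, it dies on a closed subset `T` of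
`V` of dimension `≤ m`. By the localization sequence of the union of the closure of `T` and the
support of `α`, the class `α` comes from the part of this union in `Y`, and this part has dimension
`≤ m - 1` (`exists_pushHZ_eq`). So `α` equals in `H_n(Z_m(X))` the push-forward of a class of
`H_n(Z_{m-1}(Y))`, and, by the hypothesis on `Y`, of a class of `H_n(Z_p(Y))`.

The geometric input is that the closure of `T` has the dimension of `T`, and that the points outside
of `T` have smaller dimension (`closureDim_le_of_specializes`, `exists_closureDim_le`). The dimension
is that of compactifications over `B`, so one has to compare a compactification of the closure of
a point `x` with one of the closure of a generalization `y` of `x`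
(`exists_le_topologicalKrullDim`). A chain of specializations in the former lies in an affine open
subscheme. The coordinates of this subscheme define a rational map to a projective space `P`, which can
be extended from the closure of `x` to an affine neighbourhood of `x` in `X`, and the closure of `y`
has a compactification to which this extension extends (`exists_pointCompactification`). This
compactification maps properly to `P`, so that the chain can be lifted to it.
-/

namespace Niveau

variable {B : Scheme.{u}} {C : SchemeCat B}

theorem DimLE.union {X : Over B} {Z W : Set X.left} {p : ℤ} (hZ : DimLE X Z p)
    (hW : DimLE X W p) : DimLE X (Z ∪ W) p := fun x hx => hx.elim (hZ x) (hW x)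

theorem DimLE.eq_empty {X : Over B} {Z : Set X.left} {p : ℤ} (hZ : DimLE X Z p)
    (hp : p < 0) : Z = ∅ := by
  refine Set.eq_empty_iff_forall_notMem.2 fun x hx => ?_
  obtain ⟨n, hn, -⟩ := hZ x hx
  lia

/-! ### Localization sequences of reduced locally closed subschemes -/

namespace HomologyTheory

variable {R : Type v} [Ring R] (H : HomologyTheory.{u, v, w} C R) {X Y V : C.Obj}

/-- The localization sequence of the empty scheme as a closed subscheme of itself, with itself as
open complement, begins with two identities. -/
theorem subsingleton_grp_of_isEmpty (n : ℤ) (T : C.Obj) [IsEmpty T.1.left] :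
    Subsingleton (H.grp n T) := by
  have h : IsClosedOpenPair (𝟙 T.1) (𝟙 T.1) :=
    ⟨by rw [Over.id_left]; infer_instance, by rw [Over.id_left]; infer_instance,
      Subsingleton.elim _ _⟩
  refine ⟨fun a b => ?_⟩
  have key : ∀ x : H.grp n T, x = 0 := fun x => by
    have := (H.exact_push_pull n _ _ h x).2 ⟨x, by rw [H.push_id]; rfl⟩
    rwa [H.pull_id] at this
  rw [key a, key b]

theorem subsingleton_grp_of_supp_eq_empty (n : ℤ) (P : Piece X) (h : P.supp = ∅) :
    Subsingleton (H.grp n P.dom) := by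
  have : IsEmpty P.dom.1.left := Set.range_eq_empty_iff.1 h
  exact H.subsingleton_grp_of_isEmpty n P.dom

theorem pPush_self (n : ℤ) {P : Piece X} (h : P.ClosedIn P) : H.pPush n P P h = LinearMap.id :=
  (H.push_congr n (P.hom_ext (by rw [Piece.lift_ι, Category.id_comp])) _).trans
    (H.push_id n P.dom)

theorem pPush_bijective_of_supp_eq (n : ℤ) {P Q : Piece X} (h : P.ClosedIn Q)
    (e : P.supp = Q.supp) : Function.Bijective (H.pPush n P Q h) := by
  have h' := closedIn_of_eq e.symm
  refine Function.bijective_iff_has_inverse.2 ⟨H.pPush n Q P h', fun x => ?_, fun x => ?_⟩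
  · rw [← LinearMap.comp_apply, H.pPush_comp n h h' (closedIn_of_eq rfl), pPush_self]; rfl
  · rw [← LinearMap.comp_apply, H.pPush_comp n h' h (closedIn_of_eq rfl), pPush_self]; rfl

theorem pPush_pPull_exact (n : ℤ) {Z U Q : Piece X} (hZ : Z.ClosedIn Q)
    (hU : U.supp = Q.supp \ Z.supp) (hU' : U.OpenIn Q) :
    Function.Exact (H.pPush n Z Q hZ) (H.pPull n Q U hU') :=
  H.exact_push_pull n _ _ (Piece.isClosedOpenPair_lift hZ (Piece.openIn_compl hZ hU) hU)

theorem pPull_pBdry_exact (n : ℤ) {Z U Q : Piece X} (hZ : Z.ClosedIn Q)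
    (hU : U.supp = Q.supp \ Z.supp) (hU' : U.OpenIn Q) :
    Function.Exact (H.pPull n Q U hU') (H.pBdry n Z U Q hZ hU) :=
  H.exact_pull_bdry n _ _ (Piece.isClosedOpenPair_lift hZ (Piece.openIn_compl hZ hU) hU)

/-! ### Elements of the direct limits -/

instance (p : ℤ) : Nonempty (ClosedLE X p) := ⟨⟨⊥, dimLE_empty _ _⟩⟩

instance (p : ℤ) : IsDirectedOrder (ClosedLE X p) :=
  ⟨fun Z W => ⟨⟨Z.1 ⊔ W.1, by rw [Closeds.coe_sup]; exact Z.2.union W.2⟩,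
    (le_sup_left : Z.1 ≤ Z.1 ⊔ W.1), (le_sup_right : W.1 ≤ Z.1 ⊔ W.1)⟩⟩

instance (p : ℤ) : Nonempty (ClosedPair X p) :=
  ⟨⟨(⊥, ⊥), dimLE_empty _ _, dimLE_empty _ _, le_rfl⟩⟩

instance (p : ℤ) : IsDirectedOrder (ClosedPair X p) :=
  ⟨fun Z W => ⟨⟨(Z.1.1 ⊔ W.1.1, Z.1.2 ⊔ W.1.2),
      by rw [Closeds.coe_sup]; exact Z.2.1.union W.2.1,
      by rw [Closeds.coe_sup]; exact Z.2.2.1.union W.2.2.1, sup_le_sup Z.2.2.2 W.2.2.2⟩,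
    (le_sup_left : Z.1 ≤ Z.1 ⊔ W.1), (le_sup_right : W.1 ≤ Z.1 ⊔ W.1)⟩⟩

theorem pPull_self (n : ℤ) {P : Piece X} (h : P.OpenIn P) : H.pPull n P P h = LinearMap.id :=
  (H.pull_congr n (P.hom_ext (by rw [Piece.lift_ι, Category.id_comp])) _).trans
    (H.pull_id n P.dom)

theorem closedMap_closedMap (n : ℤ) {Z W T : Closeds X.1.left} (h : Z ≤ W) (h' : W ≤ T)
    (x) : H.closedMap n W T h' (H.closedMap n Z W h x) = H.closedMap n Z T (h.trans h') x :=
  LinearMap.congr_fun (H.pPush_comp n (closedIn_closedPiece h) (closedIn_closedPiece h')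
    (closedIn_closedPiece (h.trans h'))) x

theorem diffMap_diffMap (n : ℤ) {Z W T : Closeds X.1.left × Closeds X.1.left} (h : Z ≤ W)
    (h' : W ≤ T) (x) :
    H.diffMap n W T h' (H.diffMap n Z W h x) = H.diffMap n Z T (h.trans h') x := by
  have e1 := H.pPull_pPush n (closedIn_diffPiece_left h.1 W.2) (openIn_diffPiece_right W.1 h'.2)
    (closedIn_diffPiece_left h.1 T.2) (openIn_diffPiece_right Z.1 h'.2) (by
      simp only [supp_diffPiece]
      ext y
      have := @h.1 y
      have := @h'.2 y
      simp only [Set.mem_sdiff, Set.mem_inter_iff, SetLike.mem_coe] at *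
      tauto)
  have e2 := H.pPull_comp n (openIn_diffPiece_right Z.1 h'.2) (openIn_diffPiece_right Z.1 h.2)
    (openIn_diffPiece_right Z.1 (h.2.trans h'.2))
  have e3 := H.pPush_comp n (closedIn_diffPiece_left h.1 T.2) (closedIn_diffPiece_left h'.1 T.2)
    (closedIn_diffPiece_left (h.1.trans h'.1) T.2)
  let y := H.pPull n _ _ (openIn_diffPiece_right Z.1 h.2) x
  refine (congrArg (H.pPush n _ _ (closedIn_diffPiece_left h'.1 T.2))
    (LinearMap.congr_fun e1 y)).trans ((LinearMap.congr_fun e3 _).trans ?_)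
  exact congrArg (H.pPush n _ _ (closedIn_diffPiece_left (h.1.trans h'.1) T.2))
    (LinearMap.congr_fun e2 x)

instance (p n : ℤ) : DirectedSystem
    (fun Z : ClosedLE X p => H.grp n (closedPiece Z.1 : Piece X).dom)
    (fun Z W h => H.closedMap n Z.1 W.1 h) where
  map_self _ x := by rw [closedMap, pPush_self]; rfl
  map_map _ _ _ _ _ x := H.closedMap_closedMap n _ _ x

instance (p n : ℤ) : DirectedSystem
    (fun Z : ClosedPair X p => H.grp n (diffPiece Z.1.1 Z.1.2 : Piece X).dom)
    (fun Z W h => H.diffMap n Z.1 W.1 h) where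
  map_self _ x := by rw [diffMap, pPush_self, pPull_self]; rfl
  map_map _ _ _ _ _ x := H.diffMap_diffMap n _ _ x

open Classical in
/-- The structure map `H_n(Z) ⟶ H_n(Z_p(X))` of the direct limit. -/
noncomputable def toHZ {p : ℤ} (n : ℤ) (Z : ClosedLE X p) :
    H.grp n (closedPiece Z.1 : Piece X).dom →ₗ[R] H.HZ X p n :=
  Module.DirectLimit.of R (ClosedLE X p) (fun Z => H.grp n (closedPiece Z.1 : Piece X).dom)
    (fun Z W h => H.closedMap n Z.1 W.1 h) Z

open Classical in
/-- The structure map `H_n(Z \ Z') ⟶ H_n(Z_p/Z_{p-1}(X))` of the direct limit. -/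
noncomputable def toHZZ {p : ℤ} (n : ℤ) (Z : ClosedPair X p) :
    H.grp n (diffPiece Z.1.1 Z.1.2 : Piece X).dom →ₗ[R] H.HZZ X p n :=
  Module.DirectLimit.of R (ClosedPair X p)
    (fun Z => H.grp n (diffPiece Z.1.1 Z.1.2 : Piece X).dom)
    (fun Z W h => H.diffMap n Z.1 W.1 h) Z

variable {H}

theorem toHZ_closedMap {p n : ℤ} {Z W : ClosedLE X p} (h : Z ≤ W) (x) :
    H.toHZ n W (H.closedMap n Z.1 W.1 h x) = H.toHZ n Z x := by
  classical exact Module.DirectLimit.of_f (hij := h)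

theorem toHZZ_diffMap {p n : ℤ} {Z W : ClosedPair X p} (h : Z ≤ W) (x) :
    H.toHZZ n W (H.diffMap n Z.1 W.1 h x) = H.toHZZ n Z x := by
  classical exact Module.DirectLimit.of_f (hij := h)

theorem exists_toHZ {p n : ℤ} (a : H.HZ X p n) : ∃ Z x, H.toHZ n Z x = a := by
  classical exact Module.DirectLimit.exists_of a

theorem exists_toHZZ {p n : ℤ} (a : H.HZZ X p n) : ∃ Z x, H.toHZZ n Z x = a := by
  classical exact Module.DirectLimit.exists_of a

theorem exists_of_toHZ_eq_zero {p n : ℤ} {Z : ClosedLE X p} {x} (h : H.toHZ n Z x = 0) :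
    ∃ (W : ClosedLE X p) (hZW : Z ≤ W), H.closedMap n Z.1 W.1 hZW x = 0 := by
  classical exact Module.DirectLimit.of.zero_exact h

theorem exists_of_toHZZ_eq_zero {p n : ℤ} {Z : ClosedPair X p} {x} (h : H.toHZZ n Z x = 0) :
    ∃ (W : ClosedPair X p) (hZW : Z ≤ W), H.diffMap n Z.1 W.1 hZW x = 0 := by
  classical exact Module.DirectLimit.of.zero_exact h

theorem incl_toHZ {p p' n : ℤ} (h : p ≤ p') (Z : ClosedLE X p) (x) :
    H.incl X n h (H.toHZ n Z x) = H.toHZ n ⟨Z.1, Z.2.mono h⟩ x := by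
  classical exact Module.DirectLimit.lift_of _ _ _

theorem proj_toHZ {p n : ℤ} (Z : ClosedLE X p) (x) :
    H.proj X p n (H.toHZ n Z x) =
      H.toHZZ n ⟨(Z.1, ⊥), Z.2, dimLE_empty _ _, bot_le⟩
        (H.pPull n _ _ (openIn_diffPiece Z.1 ⊥) x) := by
  classical exact Module.DirectLimit.lift_of _ _ _

theorem conn_toHZZ {p n : ℤ} (Z : ClosedPair X p) (x) :
    H.conn X p n (H.toHZZ n Z x) =
      H.toHZ (n - 1) ⟨Z.1.2, Z.2.2.1⟩
        (H.pBdry n _ _ _ (closedIn_closedPiece Z.2.2.2) diffPiece_eq x) := by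
  classical exact Module.DirectLimit.lift_of _ _ _

theorem pushHZ_toHZ {i : Y.1 ⟶ X.1} (hi : IsClosedImmersion i.left) {p n : ℤ}
    (Z : ClosedLE Y p) (x) :
    H.pushHZ hi p n (H.toHZ n Z x) =
      H.toHZ n ⟨image hi Z.1, Z.2.image hi⟩ (H.closedPush hi n Z.1 x) := by
  classical exact Module.DirectLimit.lift_of _ _ _

theorem pushHZZ_toHZZ {i : Y.1 ⟶ X.1} (hi : IsClosedImmersion i.left) {p n : ℤ}
    (Z : ClosedPair Y p) (x) :
    H.pushHZZ hi p n (H.toHZZ n Z x) =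
      H.toHZZ n ⟨(image hi Z.1.1, image hi Z.1.2), Z.2.1.image hi, Z.2.2.1.image hi,
        image_mono hi Z.2.2.2⟩ (H.diffPush hi n Z.1.1 Z.1.2 x) := by
  classical exact Module.DirectLimit.lift_of _ _ _

theorem pullHZ_toHZ {j : V.1 ⟶ X.1} (hj : IsOpenImmersion j.left) {p n : ℤ}
    (Z : ClosedLE X p) (x) :
    H.pullHZ hj p n (H.toHZ n Z x) =
      H.toHZ n ⟨preimage j Z.1, Z.2.preimage hj⟩ (H.closedPull hj n Z.1 x) := by
  classical exact Module.DirectLimit.lift_of _ _ _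

theorem pullHZZ_toHZZ {j : V.1 ⟶ X.1} (hj : IsOpenImmersion j.left) {p n : ℤ}
    (Z : ClosedPair X p) (x) :
    H.pullHZZ hj p n (H.toHZZ n Z x) =
      H.toHZZ n ⟨(preimage j Z.1.1, preimage j Z.1.2), Z.2.1.preimage hj, Z.2.2.1.preimage hj,
        preimage_mono Z.2.2.2⟩ (H.diffPull hj n Z.1.1 Z.1.2 x) := by
  classical exact Module.DirectLimit.lift_of _ _ _

theorem incl_incl {p p' p'' n : ℤ} (h : p ≤ p') (h' : p' ≤ p'') (a : H.HZ X p n) :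
    H.incl X n h' (H.incl X n h a) = H.incl X n (h.trans h') a := by
  obtain ⟨Z, x, rfl⟩ := exists_toHZ a
  simp only [incl_toHZ]

variable (H)

theorem subsingleton_HZ {p : ℤ} (n : ℤ) (hp : p < 0) : Subsingleton (H.HZ X p n) := by
  refine ⟨fun a b => ?_⟩
  have key : ∀ a : H.HZ X p n, a = 0 := fun a => by
    obtain ⟨Z, x, rfl⟩ := exists_toHZ a
    have := H.subsingleton_grp_of_supp_eq_empty n (closedPiece Z.1 : Piece X)
      (by rw [supp_closedPiece, Z.2.eq_empty hp])
    rw [Subsingleton.elim x 0, map_zero]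
  rw [key a, key b]

/-! ### Exactness of the niveau sequence -/

theorem conn_proj (p n : ℤ) (a : H.HZ X p n) : H.conn X p n (H.proj X p n a) = 0 := by
  obtain ⟨Z, x, rfl⟩ := exists_toHZ a
  rw [proj_toHZ, conn_toHZZ]
  have := H.subsingleton_grp_of_supp_eq_empty (n - 1) (closedPiece (⊥ : Closeds X.1.left) : Piece X)
    (by rw [supp_closedPiece]; rfl)
  rw [Subsingleton.elim (H.pBdry _ _ _ _ _ _ _) 0, map_zero]

/-- Exactness at `H_n(Z_p/Z_{p-1}(X))`. If the boundary of a class on `Z \ Z'` dies on a bigger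
closed subset `T ⊇ Z'`, the restriction of the class to `(Z ∪ T) \ T` lifts to `Z ∪ T`. -/
theorem exists_proj_eq {p n : ℤ} {b : H.HZZ X p n} (hb : H.conn X p n b = 0) :
    ∃ a, H.proj X p n a = b := by
  obtain ⟨Z, x, rfl⟩ := exists_toHZZ b
  rw [conn_toHZZ] at hb
  obtain ⟨T, hT, h0⟩ := exists_of_toHZ_eq_zero hb
  have hT' : Z.1.2 ≤ T.1 := hT
  let W : ClosedPair X p := ⟨(Z.1.1 ⊔ T.1, T.1),
    by rw [Closeds.coe_sup]; exact Z.2.1.union (T.2.mono (by omega)), T.2, le_sup_right⟩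
  have hZW : Z ≤ W := ⟨(le_sup_left : Z.1.1 ≤ Z.1.1 ⊔ T.1), hT'⟩
  have e := H.pBdry_pPush n (closedIn_closedPiece Z.2.2.2) diffPiece_eq
    (closedIn_closedPiece W.2.2.2) diffPiece_eq (closedIn_closedPiece hZW.1)
    (closedIn_closedPiece hZW.2) (openIn_diffPiece_right Z.1.1 hZW.2)
    (closedIn_diffPiece_left hZW.1 W.1.2) (by
      rw [supp_diffPiece, supp_diffPiece, supp_closedPiece]
      ext x
      have := @hZW.1 x
      simp only [Set.mem_sdiff, Set.mem_inter_iff, SetLike.mem_coe] at this ⊢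
      tauto)
  have e0 : H.pBdry n _ _ _ (closedIn_closedPiece W.2.2.2) diffPiece_eq
      (H.diffMap n Z.1 W.1 hZW x) = 0 := (LinearMap.congr_fun e x).symm.trans h0
  obtain ⟨z, hz⟩ := (H.pPull_pBdry_exact n (closedIn_closedPiece W.2.2.2) diffPiece_eq
    (openIn_diffPiece W.1.1 W.1.2) _).1 e0
  refine ⟨H.toHZ n ⟨W.1.1, W.2.1⟩ z, ?_⟩
  rw [proj_toHZ, ← toHZZ_diffMap hZW, ← hz]
  have hle : (⟨(W.1.1, ⊥), W.2.1, dimLE_empty _ _, bot_le⟩ : ClosedPair X p) ≤ W :=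
    ⟨le_rfl, bot_le⟩
  rw [← toHZZ_diffMap hle, diffMap, pPush_self]
  exact congrArg _ (LinearMap.congr_fun (H.pPull_comp n (openIn_diffPiece_right W.1.1 bot_le)
    (openIn_diffPiece W.1.1 ⊥) (openIn_diffPiece W.1.1 W.1.2)) z)

/-- Exactness at `H_n(Z_p(X))`. -/
theorem exists_incl_eq {p n : ℤ} {a : H.HZ X p n} (ha : H.proj X p n a = 0) :
    ∃ b, H.incl X n (show p - 1 ≤ p by omega) b = a := by
  obtain ⟨Z, x, rfl⟩ := exists_toHZ a
  rw [proj_toHZ] at ha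
  obtain ⟨W, hZW, h0⟩ := exists_of_toHZZ_eq_zero ha
  have hZW' : Z.1 ≤ W.1.1 := hZW.1
  have e1 := H.pPull_pPush n (closedIn_closedPiece hZW') (openIn_diffPiece W.1.1 W.1.2)
    (closedIn_diffPiece_left hZW' W.1.2) (openIn_diffPiece Z.1 W.1.2) (by
      simp only [supp_diffPiece, supp_closedPiece]
      ext y
      have := @hZW' y
      simp only [Set.mem_sdiff, Set.mem_inter_iff, SetLike.mem_coe] at *
      tauto)
  have e2 := H.pPull_comp n (openIn_diffPiece_right Z.1 (bot_le : ⊥ ≤ W.1.2))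
    (openIn_diffPiece Z.1 ⊥) (openIn_diffPiece Z.1 W.1.2)
  have h1 : H.pPull n _ _ (openIn_diffPiece W.1.1 W.1.2) (H.closedMap n Z.1 W.1.1 hZW' x) = 0 := by
    refine (LinearMap.congr_fun e1 x).trans (Eq.trans ?_ h0)
    exact congrArg (H.pPush n _ _ _) (LinearMap.congr_fun e2 x).symm
  obtain ⟨t, ht⟩ := (H.pPush_pPull_exact n (closedIn_closedPiece W.2.2.2) diffPiece_eq
    (openIn_diffPiece W.1.1 W.1.2) _).1 h1
  refine ⟨H.toHZ n ⟨W.1.2, W.2.2.1⟩ t, ?_⟩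
  rw [incl_toHZ]
  have hle : (⟨W.1.2, W.2.2.1.mono (by omega)⟩ : ClosedLE X p) ≤ ⟨W.1.1, W.2.1⟩ := W.2.2.2
  have hle' : Z ≤ ⟨W.1.1, W.2.1⟩ := hZW'
  rw [← toHZ_closedMap hle, ← toHZ_closedMap hle']
  exact congrArg _ ht

theorem pullHZZ_pushHZZ {i : Y.1 ⟶ X.1} {j : V.1 ⟶ X.1} (h : IsClosedOpenPair i j) {p n : ℤ}
    (b : H.HZZ Y p n) : H.pullHZZ h.isOpen p n (H.pushHZZ h.closed p n b) = 0 := by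
  obtain ⟨Z, x, rfl⟩ := exists_toHZZ b
  have he : (diffPiece (preimage j (image h.closed Z.1.1))
      (preimage j (image h.closed Z.1.2)) : Piece V).supp = ∅ := by
    rw [supp_diffPiece]
    refine Set.eq_empty_iff_forall_notMem.2 fun v hv => ?_
    obtain ⟨y, -, hy⟩ := hv.1
    exact h.range_eq.subset ⟨v, rfl⟩ ⟨y, hy⟩
  have := H.subsingleton_grp_of_supp_eq_empty n _ he
  have h0 : H.diffPull h.isOpen n (image h.closed Z.1.1) (image h.closed Z.1.2)
      (H.diffPush h.closed n Z.1.1 Z.1.2 x) = 0 := Subsingleton.elim _ _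
  rw [pushHZZ_toHZZ, pullHZZ_toHZZ]
  exact (congrArg _ h0).trans (map_zero _)

/-! ### The filtration of `H_n(Z_m(X))` by dimension of support -/

/-- With `exists_proj_eq_of_mem_Zinf`, this says that `Z^∞` is the image of `π`. -/
theorem proj_mem_Zinf {p q : ℤ} (a : H.HZ X p (p + q)) :
    H.proj X p (p + q) a ∈ H.Zinf X p q := by
  rw [Zinf, Submodule.mem_iInf]
  intro r
  rw [Zsub, Submodule.mem_comap, conn_proj]
  exact zero_mem _

/-- There are no supports of negative dimension, so that `Z^∞` is the kernel of `δ`, which is the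
image of `π`. -/
theorem exists_proj_eq_of_mem_Zinf {p q : ℤ} {b : H.E1 X p q} (hb : b ∈ H.Zinf X p q) :
    ∃ a, H.proj X p (p + q) a = b := by
  refine H.exists_proj_eq ?_
  rw [Zinf, Submodule.mem_iInf] at hb
  obtain ⟨y, hy⟩ := hb p.toNat
  have := H.subsingleton_HZ (X := X) (p := p - 1 - p.toNat) (p + q - 1) (by omega)
  rw [← hy, Subsingleton.elim y 0, map_zero]

theorem proj_incl {p n : ℤ} (h : p - 1 ≤ p) (a : H.HZ X (p - 1) n) :
    H.proj X p n (H.incl X n h a) = 0 := by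
  obtain ⟨Z, x, rfl⟩ := exists_toHZ a
  rw [incl_toHZ, proj_toHZ]
  let W : ClosedPair X p := ⟨(Z.1, Z.1), Z.2.mono (by omega), Z.2, le_rfl⟩
  have hle : (⟨(Z.1, ⊥), Z.2.mono (by omega), dimLE_empty _ _, bot_le⟩ : ClosedPair X p) ≤ W :=
    ⟨le_rfl, bot_le⟩
  have := H.subsingleton_grp_of_supp_eq_empty n (diffPiece Z.1 Z.1 : Piece X) (by
    rw [supp_diffPiece, Set.sdiff_self])
  rw [← toHZZ_diffMap hle, Subsingleton.elim (H.diffMap _ _ _ _ _) 0, map_zero]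

/-- With `m = p + r`, the image under `π` of a class lies in `B^r` exactly if the image of the class
in `H_n(Z_m(X))` comes from `H_n(Z_{p-1}(X))`. -/
theorem proj_mem_Bsub_iff {p q m : ℤ} {r : ℕ} (hm : p + r = m) (hp : p ≤ m)
    (a : H.HZ X p (p + q)) :
    H.proj X p (p + q) a ∈ H.Bsub X p q r ↔
      ∃ b : H.HZ X (p - 1) (p + q),
        H.incl X (p + q) (show p - 1 ≤ m by omega) b = H.incl X (p + q) hp a := by
  subst hm
  constructor
  · rintro ⟨c, hc, hca⟩
    have hca' : H.proj X p (p + q) (a - c) = 0 := by rw [map_sub, hca, sub_self]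
    obtain ⟨b, hb⟩ := H.exists_incl_eq hca'
    refine ⟨b, ?_⟩
    rw [← incl_incl (show p - 1 ≤ p by omega) hp, hb, map_sub, LinearMap.mem_ker.1 hc, sub_zero]
  · rintro ⟨b, hb⟩
    refine ⟨a - H.incl X (p + q) (show p - 1 ≤ p by omega) b, ?_, ?_⟩
    · rw [SetLike.mem_coe, LinearMap.mem_ker, map_sub, incl_incl, hb, sub_self]
    · rw [map_sub, proj_incl, sub_zero]

theorem mk_eq_zero_iff {p q : ℤ} {r : ℕ} (b : H.Zinf X p q) :
    (Submodule.Quotient.mk b : H.ZinfB X p q r) = 0 ↔ (b : H.E1 X p q) ∈ H.Bsub X p q r :=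
  Submodule.Quotient.mk_eq_zero _

/-- The quotient `Z^∞_{s,t}/B^r_{s,t}` is the graded piece of degree `s` of the filtration of
`H_n(Z_m(X))` by the images of the `H_n(Z_s(X))`, where `n = s + t` and `m = s + r`. If it
vanishes, this filtration does not jump at `s`. -/
theorem exists_incl_eq_incl {s t n m : ℤ} {r : ℕ} (h : Subsingleton (H.ZinfB X s t r))
    (hn : s + t = n) (hm : s + r = m) (hs : s ≤ m) (a : H.HZ X s n) :
    ∃ b : H.HZ X (s - 1) n, H.incl X n (show s - 1 ≤ m by omega) b = H.incl X n hs a := by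
  subst hn
  exact (H.proj_mem_Bsub_iff hm hs a).1
    ((H.mk_eq_zero_iff ⟨_, H.proj_mem_Zinf a⟩).1 (Subsingleton.elim _ _))

/-- If the graded pieces in degrees `s' < s ≤ s''` vanish, everything coming from `Z_{s''}`
already comes from `Z_{s'}`. -/
theorem exists_incl_eq_incl_of_forall {n m s' : ℤ} (k : ℕ) (hk : s' + k ≤ m)
    (h : ∀ s, s' < s → s ≤ s' + k → Subsingleton (H.ZinfB X s (n - s) (m - s).toNat))
    (a : H.HZ X (s' + k) n) :
    ∃ b : H.HZ X s' n, H.incl X n (show s' ≤ m by omega) b = H.incl X n hk a := by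
  induction k with
  | zero =>
    exact ⟨H.incl X n (show s' + (0 : ℕ) ≤ s' by omega) a, by rw [incl_incl]⟩
  | succ k ih =>
    obtain ⟨b, hb⟩ := H.exists_incl_eq_incl (m := m) (n := n)
      (h (s' + (k + 1 : ℕ)) (by omega) le_rfl) (by omega) (by omega) hk a
    obtain ⟨c, hc⟩ := ih (by omega) (fun s hs hs' => h s hs (by omega))
      (H.incl X n (show s' + (k + 1 : ℕ) - 1 ≤ s' + k by omega) b)
    exact ⟨c, by rw [hc, incl_incl, hb]⟩

/-- If all graded pieces in degrees `≤ s` vanish, the image of `H_n(Z_s(X))` is zero. -/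
theorem incl_eq_zero_of_forall {s m n : ℤ} (hs : s ≤ m)
    (h : ∀ t ≤ s, Subsingleton (H.ZinfB X t (n - t) (m - t).toNat)) (a : H.HZ X s n) :
    H.incl X n hs a = 0 := by
  -- a negative dimension from which `s` is reached by adding a natural number
  obtain ⟨s', k, hs', hk⟩ : ∃ (s' : ℤ) (k : ℕ), s' < 0 ∧ s' + k = s :=
    ⟨min s (-1), (s - min s (-1)).toNat, by omega, by omega⟩
  obtain ⟨b, hb⟩ := H.exists_incl_eq_incl_of_forall (m := m) (n := n) (s' := s') k (by omega)
    (fun t _ ht => h t (by omega)) (H.incl X n (by omega) a)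
  have := H.subsingleton_HZ (X := X) n hs'
  rw [incl_incl, Subsingleton.elim b 0, map_zero] at hb
  exact hb.symm

theorem pullZinfB_mk_eq_zero_iff {j : V.1 ⟶ X.1} (hj : IsOpenImmersion j.left) {p q : ℤ}
    {r : ℕ} (b : H.Zinf X p q) :
    H.pullZinfB hj p q r (Submodule.Quotient.mk b) = 0 ↔
      H.pullHZZ hj p (p + q) b ∈ H.Bsub V p q r :=
  Submodule.Quotient.mk_eq_zero _

theorem pushZinfB_mk_eq_mk_iff {i : Y.1 ⟶ X.1} (hi : IsClosedImmersion i.left) {p q : ℤ}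
    {r : ℕ} (b : H.Zinf Y p q) (b' : H.Zinf X p q) :
    H.pushZinfB hi p q r (Submodule.Quotient.mk b) = Submodule.Quotient.mk b' ↔
      H.pushHZZ hi p (p + q) b - b' ∈ H.Bsub X p q r :=
  Submodule.Quotient.eq _

theorem pullZinfB_pushZinfB {i : Y.1 ⟶ X.1} {j : V.1 ⟶ X.1} (h : IsClosedOpenPair i j)
    {p q : ℤ} {r : ℕ} (x : H.ZinfB Y p q r) :
    H.pullZinfB h.isOpen p q r (H.pushZinfB h.closed p q r x) = 0 := by
  obtain ⟨b, rfl⟩ := Submodule.Quotient.mk_surjective _ x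
  have hZ := H.Zinf_le (H.pushHZZ h.closed p (p + q)) (fun p' => H.pushHZ h.closed p' _)
    (fun _ _ hp => H.pushHZ_incl h.closed _ hp) (H.pushHZ_conn h.closed _ _)
  have hb : H.pushZinfB h.closed p q r (Submodule.Quotient.mk b) =
      Submodule.Quotient.mk ⟨H.pushHZZ h.closed p (p + q) b, hZ b.2⟩ := rfl
  rw [hb, pullZinfB_mk_eq_zero_iff, H.pullHZZ_pushHZZ h]
  exact zero_mem _

end HomologyTheory

end Niveau

namespace Niveau

/-! ### Projective space and immersions into it -/

namespace ProjectiveSpace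

open MvPolynomial

variable (n : ℕ)

/-- The grading by degree of the polynomial ring over `ℤ` in the homogeneous coordinates; the
coordinate `X none` defines the standard affine chart. -/
abbrev grading : ℕ → Submodule (ULift.{u} ℤ) (MvPolynomial (Option (Fin n)) (ULift.{u} ℤ)) :=
  homogeneousSubmodule (Option (Fin n)) (ULift.{u} ℤ)

noncomputable instance : GradedRing (grading.{u} n) := MvPolynomial.gradedAlgebra

/-- Projective space `ℙ^n` over `ℤ`. -/
noncomputable abbrev space : Scheme.{u} := Proj (grading.{u} n)

instance isProper_terminal_from : IsProper (Limits.terminal.from (space.{u} n)) := by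
  have : IsScalarTower (ULift.{u} ℤ) (grading.{u} n 0)
      (MvPolynomial (Option (Fin n)) (ULift.{u} ℤ)) := .of_algebraMap_eq
    (R := ULift.{u} ℤ) (S := grading.{u} n 0) (A := MvPolynomial (Option (Fin n)) (ULift.{u} ℤ))
    fun _ => rfl
  have : Algebra.FiniteType (grading.{u} n 0) (MvPolynomial (Option (Fin n)) (ULift.{u} ℤ)) :=
    .of_restrictScalars_finiteType (ULift.{u} ℤ) _ _
  have hsurj : Function.Surjective (algebraMap (ULift.{u} ℤ) (grading.{u} n 0)) := by
    rintro ⟨x, hx⟩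
    have h := totalDegree_eq_zero_iff_eq_C.1 ((totalDegree_zero_iff_isHomogeneous _).2 hx)
    exact ⟨_, Subtype.ext h.symm⟩
  let φ : CommRingCat.of (ULift.{u} ℤ) ⟶ CommRingCat.of (grading.{u} n 0) :=
    CommRingCat.ofHom (algebraMap (ULift.{u} ℤ) (grading.{u} n 0))
  have : IsClosedImmersion (Spec.map φ) := IsClosedImmersion.spec_of_surjective φ hsurj
  have e : Limits.terminal.from (space.{u} n) = (Proj.toSpecZero (grading.{u} n) ≫ Spec.map φ) ≫
      (specULiftZIsTerminal.uniqueUpToIso Limits.terminalIsTerminal).hom :=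
    Limits.terminal.hom_ext _ _
  rw [e]
  infer_instance

variable {n} in
theorem X_mem_grading (o : Option (Fin n)) : X o ∈ grading.{u} n 1 := isHomogeneous_X _ _

/-- The coordinate ring of the standard affine chart. -/
abbrev chart : Type u :=
  HomogeneousLocalization.Away (grading.{u} n) (X none)

/-- The standard affine chart of projective space. -/
noncomputable def chartι : Spec (.of (chart.{u} n)) ⟶ space.{u} n :=
  Proj.awayι (grading.{u} n) (X none) (X_mem_grading none) one_pos

instance : IsOpenImmersion (chartι.{u} n) := by
  unfold chartι
  infer_instance

variable {n}

/-- The ring homomorphism from the coordinate ring of the standard chart which sends the affine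
coordinates to the given elements. -/
noncomputable def evalChart {A : Type u} [CommRing A] (c : Fin n → A) : chart.{u} n →+* A :=
  (Localization.awayLift (eval₂Hom ((Int.castRingHom A).comp ULift.ringEquiv.toRingHom)
    (fun o => o.elim 1 c)) (X none) (by simp)).comp (algebraMap (chart.{u} n) (Localization.Away _))

theorem comp_evalChart {A A' : Type u} [CommRing A] [CommRing A'] (f : A →+* A') (c : Fin n → A) :
    f.comp (evalChart c) = evalChart (f ∘ c) := by
  unfold evalChart
  rw [← RingHom.comp_assoc]
  congr 1
  refine IsLocalization.ringHom_ext 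
    (Submonoid.powers (X none : MvPolynomial (Option (Fin n)) (ULift.{u} ℤ))) ?_
  refine MvPolynomial.ringHom_ext (σ := Option (Fin n)) (R := ULift.{u} ℤ) (fun r => ?_)
    (fun o => ?_)
  · simp [Localization.awayLift]
  · cases o <;> simp [Localization.awayLift]

theorem exists_evalChart_eq {A : Type u} [CommRing A] (c : Fin n → A) (k : Fin n) :
    ∃ z, evalChart c z = c k := by
  refine ⟨HomogeneousLocalization.Away.mk _ (X_mem_grading none) 1 (X (some k))
    (X_mem_grading (some k)), ?_⟩
  rw [evalChart, RingHom.comp_apply, HomogeneousLocalization.algebraMap_apply,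
    HomogeneousLocalization.Away.val_mk, Localization.mk_eq_mk', Localization.awayLift,
    IsLocalization.Away.lift, IsLocalization.lift_mk'_spec]
  simp

/-- The morphism to projective space with the given affine coordinates. -/
noncomputable def toSpace {T : Scheme.{u}} (c : Fin n → Γ(T, ⊤)) : T ⟶ space.{u} n :=
  T.toSpecΓ ≫ Spec.map (CommRingCat.ofHom (evalChart c)) ≫ chartι n

theorem comp_toSpace {T S : Scheme.{u}} (f : S ⟶ T) (c : Fin n → Γ(T, ⊤)) :
    f ≫ toSpace c = toSpace (f.appTop.hom ∘ c) := by
  unfold toSpace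
  rw [← comp_evalChart, Scheme.toSpecΓ_naturality_assoc, CommRingCat.ofHom_comp, Spec.map_comp,
    Category.assoc]
  rfl

variable (n) in
/-- Projective space `ℙ^n` over a scheme. -/
noncomputable def spaceOver (B : Scheme.{u}) : Over B :=
  Over.mk (Limits.pullback.fst (Limits.terminal.from B) (Limits.terminal.from (space.{u} n)))

instance (B : Scheme.{u}) : IsProper (spaceOver n B).hom :=
  inferInstanceAs (IsProper (Limits.pullback.fst _ _))

/-- The projection of projective space over `B` to projective space over `ℤ`. -/
noncomputable def proj (B : Scheme.{u}) : (spaceOver n B).left ⟶ space.{u} n :=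
  Limits.pullback.snd _ _

theorem hom_ext {B T : Scheme.{u}} {f g : T ⟶ (spaceOver n B).left}
    (h : f ≫ (spaceOver n B).hom = g ≫ (spaceOver n B).hom) (h' : f ≫ proj B = g ≫ proj B) :
    f = g :=
  Limits.pullback.hom_ext h h'

/-- The morphism over `B` to projective space over `B` with the given affine coordinates. -/
noncomputable def toOver {B : Scheme.{u}} (T : Over B) (c : Fin n → Γ(T.left, ⊤)) :
    T ⟶ spaceOver n B :=
  Over.homMk (Limits.pullback.lift T.hom (toSpace c) (Limits.terminal.hom_ext _ _))
    (Limits.pullback.lift_fst _ _ _)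

theorem toOver_left_proj {B : Scheme.{u}} (T : Over B) (c : Fin n → Γ(T.left, ⊤)) :
    (toOver T c).left ≫ proj B = toSpace c :=
  Limits.pullback.lift_snd _ _ _

theorem comp_toOver {B : Scheme.{u}} {S T : Over B} (f : S ⟶ T) (c : Fin n → Γ(T.left, ⊤)) :
    f ≫ toOver T c = toOver S (f.left.appTop.hom ∘ c) := by
  refine Over.OverMorphism.ext (hom_ext ?_ ?_)
  · rw [Over.w, Over.w]
  · rw [Over.comp_left, Category.assoc, toOver_left_proj, toOver_left_proj, comp_toSpace]

/-- An affine scheme of finite type over an affine open subscheme `U` of `B` is embedded into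
projective space over `B` by generators of its coordinate ring: it is closed in the product of `U`
with the standard chart. -/
theorem exists_isImmersion_toOver {B U : Scheme.{u}} (T : Over B) [IsAffine T.left] [IsAffine U]
    (a : T.left ⟶ U) [LocallyOfFiniteType a] (k : U ⟶ B) [IsOpenImmersion k] (h : a ≫ k = T.hom) :
    ∃ (n : ℕ) (c : Fin n → Γ(T.left, ⊤)), IsImmersion (toOver T c).left := by
  have hfin : a.appTop.hom.FiniteType := by
    have := LocallyOfFiniteType.finiteType_appLE a (isAffineOpen_top U) (isAffineOpen_top T.left)
      le_top
    rwa [show a.appLE ⊤ ⊤ le_top = a.appTop from a.appLE_eq_app (U := ⊤)] at this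
  algebraize [a.appTop.hom]
  obtain ⟨n, f, hf⟩ := Algebra.FiniteType.iff_quotient_mvPolynomial''.1
    (inferInstance : Algebra.FiniteType Γ(U, ⊤) Γ(T.left, ⊤))
  let c : Fin n → Γ(T.left, ⊤) := fun l => f (X l)
  refine ⟨n, c, ?_⟩
  let D : Scheme.{u} := Spec (.of (chart.{u} n))
  let d : T.left ⟶ D := T.left.toSpecΓ ≫ Spec.map (CommRingCat.ofHom (evalChart c))
  let Q := Limits.pullback (Limits.terminal.from U) (Limits.terminal.from D)
  let g : T.left ⟶ Q := Limits.pullback.lift a d (Limits.terminal.hom_ext _ _)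
  have hg : IsClosedImmersion g := by
    refine IsClosedImmersion.of_surjective_of_isAffine g fun x => ?_
    change x ∈ g.appTop.hom.range
    have ha : g ≫ Limits.pullback.fst _ _ = a := Limits.pullback.lift_fst _ _ _
    have hd : g ≫ Limits.pullback.snd _ _ = d := Limits.pullback.lift_snd _ _ _
    obtain ⟨P, rfl⟩ := hf x
    induction P using MvPolynomial.induction_on with
    | C r =>
      refine ⟨(Limits.pullback.fst (Limits.terminal.from U) (Limits.terminal.from D)).appTop r, ?_⟩
      rw [← CommRingCat.comp_apply, ← Scheme.Hom.comp_appTop, ha]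
      exact (f.commutes r).symm
    | add P Q hP hQ => rw [map_add]; exact add_mem hP hQ
    | mul_X P l hP =>
      rw [map_mul]
      refine mul_mem hP ?_
      obtain ⟨z, hz⟩ := exists_evalChart_eq c l
      refine ⟨(Limits.pullback.snd (Limits.terminal.from U) (Limits.terminal.from D)).appTop
        ((Scheme.ΓSpecIso (.of (chart.{u} n))).inv z), ?_⟩
      rw [← CommRingCat.comp_apply, ← Scheme.Hom.comp_appTop, hd, ← CommRingCat.comp_apply,
        Scheme.Hom.comp_appTop, Scheme.toSpecΓ_appTop, Scheme.ΓSpecIso_naturality,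
        Iso.inv_hom_id_assoc]
      exact hz
  let m : Q ⟶ (spaceOver n B).left := Limits.pullback.map _ _ _ _ k (chartι n) (𝟙 _)
    (Limits.terminal.hom_ext _ _) (Limits.terminal.hom_ext _ _)
  have hm : IsOpenImmersion m :=
    MorphismProperty.pullbackMap (P := @IsOpenImmersion) (inferInstanceAs (IsOpenImmersion k))
      (inferInstanceAs (IsOpenImmersion (chartι.{u} n))) (Limits.terminal.hom_ext _ _)
      (Limits.terminal.hom_ext _ _)
  have e : (toOver T c).left = g ≫ m := by
    refine hom_ext ?_ ?_
    · rw [Over.w, Category.assoc, ← h]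
      have : m ≫ (spaceOver n B).hom = Limits.pullback.fst _ _ ≫ k := Limits.pullback.lift_fst _ _ _
      rw [this]
      exact (Limits.pullback.lift_fst_assoc _ _ _ _).symm
    · rw [toOver_left_proj, Category.assoc]
      have : m ≫ proj B = Limits.pullback.snd _ _ ≫ chartι n := Limits.pullback.lift_snd _ _ _
      rw [this]
      refine Eq.trans ?_ (Limits.pullback.lift_snd_assoc _ _ _ _).symm
      simp [d, toSpace]
  rw [e]
  infer_instance

end ProjectiveSpace

end Niveau

namespace Niveau

variable {B : Scheme.{u}}

/-! ### Chains of specializations and Krull dimension -/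

/-- By passing to generic points, chains of irreducible closed subsets correspond to chains of
specializations, here indexed from the most general point downwards. -/
theorem natCast_le_topologicalKrullDim_iff {T : Type*} [TopologicalSpace T] [QuasiSober T]
    [T0Space T] {m : ℕ} : (m : WithBot ℕ∞) ≤ topologicalKrullDim T ↔
      ∃ z : ℕ → T, ∀ i < m, z i ⤳ z (i + 1) ∧ z i ≠ z (i + 1) := by
  unfold topologicalKrullDim
  rw [Order.le_krullDim_iff]
  constructor
  · rintro ⟨l, rfl⟩
    choose g hg using fun Z : IrreducibleCloseds T => QuasiSober.sober Z.isIrreducible Z.isClosed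
    refine ⟨fun i => g (l (Fin.ofNat (l.length + 1) (l.length - i))), fun i hi => ?_⟩
    have hlt : l (Fin.ofNat (l.length + 1) (l.length - (i + 1))) <
        l (Fin.ofNat (l.length + 1) (l.length - i)) := by
      refine l.strictMono ?_
      rw [Fin.lt_def, Fin.val_ofNat, Fin.val_ofNat, Nat.mod_eq_of_lt (by omega),
        Nat.mod_eq_of_lt (by omega)]
      omega
    constructor
    · rw [specializes_iff_mem_closure, (hg _).def]
      exact hlt.le (hg _).mem
    · intro e
      refine hlt.ne (SetLike.coe_injective ?_)
      rw [← (hg _).def, ← (hg (l (Fin.ofNat _ (l.length - i)))).def]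
      exact congrArg (fun r => closure {r}) e.symm
  · rintro ⟨z, hz⟩
    refine ⟨⟨m, fun i => ⟨closure {z (m - i)}, isIrreducible_singleton.closure, isClosed_closure⟩,
      fun i => ?_⟩, rfl⟩
    have h := hz (m - (i + 1)) (by omega)
    rw [show m - (i + 1) + 1 = m - (i : ℕ) by omega] at h
    refine lt_of_le_of_ne (closure_minimal ?_ isClosed_closure) fun e => h.2 ?_
    · simpa using h.1.mem_closure
    · exact (inseparable_iff_closure_eq.2 e.symm).eq

theorem exists_specializes_eq {S T : Type*} [TopologicalSpace S] [TopologicalSpace T] {g : S → T}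
    (hg : IsClosedMap g) {s : S} {y : T} (h : g s ⤳ y) : ∃ t, s ⤳ t ∧ g t = y := by
  have hy : y ∈ g '' closure {s} := by
    refine closure_minimal ?_ (hg _ isClosed_closure) h.mem_closure
    rintro _ rfl
    exact ⟨s, subset_closure rfl, rfl⟩
  obtain ⟨t, ht, rfl⟩ := hy
  exact ⟨t, specializes_iff_mem_closure.2 ht, rfl⟩

theorem natCast_le_of_forall {a b : WithBot ℕ∞}
    (h : ∀ m : ℕ, (m : WithBot ℕ∞) ≤ a → (m : WithBot ℕ∞) ≤ b) : a ≤ b := by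
  induction a with
  | bot => exact bot_le
  | coe a =>
    induction b with
    | bot => exact absurd (h 0 (by exact_mod_cast (zero_le : 0 ≤ a))) (by simp)
    | coe b =>
      rw [WithBot.coe_le_coe, ← ENat.forall_natCast_le_iff_le]
      intro m hm
      exact_mod_cast h m (by exact_mod_cast hm)

/-! ### Compactifications of closures of points -/

/-- The reduced closure of a point. -/
theorem exists_isIntegral_isClosedImmersion {X : Scheme.{u}} (η : X) :
    ∃ (S : Scheme.{u}) (s : S ⟶ X) (_ : IsIntegral S), IsClosedImmersion s ∧
      s (genericPoint S) = η := by
  let I := Scheme.IdealSheafData.vanishingIdeal ⟨closure {η}, isClosed_closure⟩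
  have hs : Set.range I.subschemeι = closure {η} := by simp [I]
  have := isReduced_subscheme_vanishingIdeal (⟨closure {η}, isClosed_closure⟩ : Closeds X)
  obtain ⟨σ, hσ⟩ : η ∈ Set.range I.subschemeι := by rw [hs]; exact subset_closure rfl
  have hσs (r : I.subscheme) : σ ⤳ r := by
    rw [← I.subschemeι.isEmbedding.isInducing.specializes_iff, hσ, specializes_iff_mem_closure,
      ← hs]
    exact ⟨r, rfl⟩
  have : IrreducibleSpace I.subscheme :=
    { isPreirreducible_univ := by
        rw [← show closure {σ} = Set.univ from Set.eq_univ_of_forall fun r => (hσs r).mem_closure]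
        exact isIrreducible_singleton.closure.isPreirreducible
      toNonempty := ⟨σ⟩ }
  refine ⟨_, I.subschemeι, isIntegral_of_irreducibleSpace_of_isReduced I.subscheme,
    inferInstance, ?_⟩
  rw [((genericPoint_specializes σ).antisymm (hσs _)).eq, hσ]

/-- Let `T` be an affine open subscheme of `X` and `g` a morphism from `T` to a proper scheme `P`.
The closure of `y` in `X` meets `T` in a closed subscheme of `T` which has a compactification to
which `g` extends: the image of the graph of `g` in the product of `P` and a projective space that
contains `T`. Hence this compactification contains the points of `T` in the closure of `y`, also
those outside of `V`. -/
theorem exists_pointCompactification [IsLocallyNoetherian B] {X V : Over B} {j : V ⟶ X}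
    (hj : IsOpenImmersion j.left) {y : V.left} {T : Over B} (t : T ⟶ X) [IsOpenImmersion t.left]
    [IsAffine T.left] {U : Scheme.{u}} [IsAffine U] (a : T.left ⟶ U) [LocallyOfFiniteType a]
    (k : U ⟶ B) [IsOpenImmersion k] (h : a ≫ k = T.hom) {P : Over B} [IsProper P.hom] (g : T ⟶ P)
    {η x : T.left} (hη : t.left η = j.left y) (hx : η ⤳ x) :
    ∃ (K : PointCompactification V y) (G : K.compact ⟶ P) (κη κx : K.compact.left),
      κη ⤳ κx ∧ (η ≠ x → κη ≠ κx) ∧ G.left κx = g.left x := by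
  obtain ⟨n, c, hc⟩ := ProjectiveSpace.exists_isImmersion_toOver T a k h
  obtain ⟨S, s, hS, hs, hσ⟩ := exists_isIntegral_isClosedImmersion η
  obtain ⟨ξ, rfl⟩ : x ∈ Set.range s :=
    hx.mem_closed s.isClosedEmbedding.isClosed_range ⟨_, hσ⟩
  -- `S` is Noetherian, so its immersion `f` into the product below is quasi-compact, and `S` is
  -- open in the scheme-theoretic image of `f`.
  have : IsLocallyNoetherian U := isLocallyNoetherian_of_isOpenImmersion k
  have : IsLocallyNoetherian T.left := LocallyOfFiniteType.isLocallyNoetherian a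
  have : IsLocallyNoetherian S := LocallyOfFiniteType.isLocallyNoetherian s
  have : IsAffine S := isAffine_of_isAffineHom s
  have : IsNoetherian S := { }
  let q : T.left ⟶ Limits.pullback (ProjectiveSpace.spaceOver n B).hom P.hom :=
    Limits.pullback.lift (ProjectiveSpace.toOver T c).left g.left (by rw [Over.w, Over.w])
  have : IsImmersion (q ≫ Limits.pullback.fst _ _) := by
    rwa [show q ≫ Limits.pullback.fst _ _ = _ from Limits.pullback.lift_fst _ _ _]
  have hq : IsImmersion q := IsImmersion.of_comp q (Limits.pullback.fst _ _)
  let f := s ≫ q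
  have : IsImmersion f := inferInstance
  have : QuasiCompact f := inferInstance
  have : IsOpenImmersion f.toImage := inferInstance
  let O : S.Opens := (s ≫ t.left) ⁻¹ᵁ j.left.opensRange
  have hO : genericPoint S ∈ O := ⟨y, by rw [Scheme.Hom.comp_apply, hσ, hη]⟩
  have : Nonempty O.toScheme := ⟨⟨_, hO⟩⟩
  have : IsIntegral O.toScheme := isIntegral_of_isOpenImmersion O.ι
  let i : O.toScheme ⟶ V.left := IsOpenImmersion.lift j.left (O.ι ≫ s ≫ t.left) (by
    rintro _ ⟨r, rfl⟩
    exact r.2)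
  have hi : i ≫ j.left = O.ι ≫ s ≫ t.left := IsOpenImmersion.lift_fac _ _ _
  have : IsImmersion (i ≫ j.left) := by rw [hi]; infer_instance
  have ef : f ≫ Limits.pullback.fst _ _ ≫ (ProjectiveSpace.spaceOver n B).hom = s ≫ T.hom := by
    rw [Category.assoc, Limits.pullback.lift_fst_assoc, Over.w]
  let O' : Over B := Over.mk (i ≫ V.hom)
  let C : Over B :=
    Over.mk (f.imageι ≫ Limits.pullback.fst _ _ ≫ (ProjectiveSpace.spaceOver n B).hom)
  let e : O' ⟶ C := Over.homMk (O.ι ≫ f.toImage) (by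
    change (O.ι ≫ f.toImage) ≫ f.imageι ≫ _ = i ≫ V.hom
    rw [Category.assoc, Scheme.Hom.toImage_imageι_assoc, ef, ← Over.w j, reassoc_of% hi, Over.w])
  refine ⟨{
    sub := O'
    integral := ‹_›
    incl := Over.homMk i rfl
    immersion := IsImmersion.of_comp i j.left
    generic := ?_
    compact := C
    proper := inferInstanceAs (IsProper (f.imageι ≫ Limits.pullback.fst _ _ ≫
      (ProjectiveSpace.spaceOver n B).hom))
    emb := e
    isOpen := inferInstanceAs (IsOpenImmersion (O.ι ≫ f.toImage))
    dense := ?_ }, Over.homMk (f.imageι ≫ Limits.pullback.snd _ _) ?_,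
    f.toImage (genericPoint S), f.toImage ξ, (genericPoint_specializes ξ).map f.toImage.continuous,
    fun hne e => hne ?_, ?_⟩
  · refine j.left.isOpenEmbedding.injective ?_
    change j.left (i (genericPoint O.toScheme)) = _
    rw [← Scheme.Hom.comp_apply, hi, Scheme.Hom.comp_apply,
      genericPoint_eq_of_isOpenImmersion, Scheme.Hom.comp_apply, hσ, hη]
  · have : DenseRange O.ι := by
      rw [DenseRange, Scheme.Opens.range_ι]
      exact O.isOpen.dense ⟨_, hO⟩
    exact f.toImage.denseRange.comp this f.toImage.continuous
  · change (f.imageι ≫ _) ≫ _ = f.imageι ≫ _ ≫ _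
    rw [Category.assoc, Limits.pullback.condition]
  · rw [← hσ, f.toImage.isOpenEmbedding.injective e]
  · change (f.imageι ≫ Limits.pullback.snd _ _) (f.toImage ξ) = _
    rw [← Scheme.Hom.comp_apply, Scheme.Hom.toImage_imageι_assoc, Category.assoc,
      Limits.pullback.lift_snd, Scheme.Hom.comp_apply]

/-- Functions on a subscheme `S` of `X` extend to an open subset of `X`, after restriction to a
neighbourhood of a given point of `S`, because `i` is surjective on stalks. -/
theorem exists_appTop_eq {S X : Scheme.{u}} (i : S ⟶ X) [SurjectiveOnStalks i] (ξ : S) {n : ℕ}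
    (d : Fin n → Γ(S, ⊤)) {U₀ : X.Opens} (hU₀ : i ξ ∈ U₀) :
    ∃ (U : X.Opens) (N : S.Opens) (φ : N.toScheme ⟶ U.toScheme) (c : Fin n → Γ(U.toScheme, ⊤)),
      U ≤ U₀ ∧ IsAffineOpen U ∧ i ξ ∈ U ∧ ξ ∈ N ∧ φ ≫ U.ι = N.ι ≫ i ∧
        ∀ l, φ.appTop.hom (c l) = N.ι.appTop.hom (d l) := by
  have key (l : Fin n) : ∃ (U : X.Opens) (s : Γ(X, U)) (N : S.Opens) (hN : N ≤ i ⁻¹ᵁ U),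
      i ξ ∈ U ∧ ξ ∈ N ∧ i.appLE U N hN s = S.presheaf.map (homOfLE le_top).op (d l) := by
    obtain ⟨σ, hσ⟩ := i.stalkMap_surjective ξ (S.presheaf.germ ⊤ ξ trivial (d l))
    obtain ⟨U, hU, s, rfl⟩ := X.presheaf.exists_germ_eq σ
    rw [Scheme.Hom.germ_stalkMap_apply] at hσ
    obtain ⟨N, hξN, iU, iV, e⟩ := S.presheaf.germ_eq (U := i ⁻¹ᵁ U) (V := ⊤) ξ hU trivial _ _ hσ
    exact ⟨U, s, N, leOfHom iU, hU, hξN, e⟩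
  choose U s N hNU hU hN e using key
  obtain ⟨U', hU', hxU', hle⟩ := exists_isAffineOpen_mem_and_subset
    (x := i ξ) (U := U₀ ⊓ Finset.univ.inf U) ⟨hU₀, by simpa using hU⟩
  have hleU (l : Fin n) : U' ≤ U l := fun r hr => by
    have := (hle hr).2
    simp at this
    exact this l
  let N' : S.Opens := i ⁻¹ᵁ U' ⊓ Finset.univ.inf N
  have hN' : ξ ∈ N' := ⟨hxU', by simpa using hN⟩
  have hleN (l : Fin n) : N' ≤ N l := fun r hr => by
    have := hr.2
    simp at this
    exact this l
  refine ⟨U', N', i.resLE U' N' inf_le_left,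
    fun l => U'.topIso.inv (X.presheaf.map (homOfLE (hleU l)).op (s l)), fun r hr => (hle hr).1,
    hU', hxU', hN', Scheme.Hom.resLE_comp_ι _ _, fun l => ?_⟩
  have h := congrArg (S.presheaf.map (homOfLE (hleN l)).op) (e l)
  have hι : N'.ι.appTop = S.presheaf.map (homOfLE le_top).op ≫ N'.topIso.inv :=
    S.presheaf.map_comp (homOfLE (le_top : N' ≤ ⊤)).op (eqToHom N'.ι_image_top).op
  rw [hι, Scheme.Hom.appTop, Scheme.Hom.resLE_app_top]
  simp only [← CommRingCat.comp_apply, Category.assoc, Iso.inv_hom_id_assoc,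
    Scheme.Hom.map_appLE_assoc, Scheme.Hom.appLE_map, ← Functor.map_comp] at h ⊢
  rw [CommRingCat.comp_apply, h]
  rfl

theorem exists_chain_lift {S T : Type*} [TopologicalSpace S] [TopologicalSpace T] {g : S → T}
    (hg : IsClosedMap g) {s : S} {z : ℕ → T} (h0 : g s ⤳ z 0) (hz : ∀ i, z i ⤳ z (i + 1)) :
    ∃ t : ℕ → S, s ⤳ t 0 ∧ (∀ i, t i ⤳ t (i + 1)) ∧ ∀ i, g (t i) = z i := by
  obtain ⟨t0, ht0, e0⟩ := exists_specializes_eq hg h0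
  choose f hf hgf using fun (i : ℕ) (t : {t // g t = z i}) =>
    exists_specializes_eq hg (s := t.1) (y := z (i + 1)) (by rw [t.2]; exact hz i)
  let t (i : ℕ) : {t // g t = z i} :=
    Nat.rec (motive := fun i => {t // g t = z i}) ⟨t0, e0⟩ (fun i t => ⟨f i t, hgf i t⟩) i
  exact ⟨fun i => (t i).1, ht0, fun i => hf i (t i), fun i => (t i).property⟩

/-- The key dimension estimate. A chain of specializations in a compactification of the closure of
`x` lies in an affine open subscheme `W`, which is embedded into a projective space. The
coordinates of this embedding are rational functions on the closure of `x` and they extend to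
functions on an affine neighbourhood of `x` in `X`, hence to a morphism from this neighbourhood to
the same projective space. A compactification of the closure of `y` to which this morphism extends
maps by a closed map to the projective space, so that the chain can be lifted to it, starting at
`x`. If `y` is a proper generalization of `x`, then it prolongs the chain. -/
theorem exists_le_topologicalKrullDim [IsLocallyNoetherian B] {X V : Over B} {j : V ⟶ X}
    (hj : IsOpenImmersion j.left) [LocallyOfFiniteType X.hom] {y : V.left} {x : X.left}
    (h : j.left y ⤳ x) (K : PointCompactification X x) {m : ℕ}
    (hm : (m : WithBot ℕ∞) ≤ topologicalKrullDim K.compact.left) :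
    ∃ K' : PointCompactification V y, (m : WithBot ℕ∞) ≤ topologicalKrullDim K'.compact.left ∧
      (j.left y ≠ x → ((m + 1 : ℕ) : WithBot ℕ∞) ≤ topologicalKrullDim K'.compact.left) := by
  have := K.integral
  have := K.immersion
  have := K.proper
  have := K.isOpen
  obtain ⟨z, hz⟩ := natCast_le_topologicalKrullDim_iff.1 hm
  -- All points of the chain, and the generic point, lie in every neighbourhood of `z m`.
  have hzm (i : ℕ) (hi : i ≤ m) : z i ⤳ z m := by
    induction hi using Nat.decreasingInduction with
    | self => rfl
    | of_succ i hi ih => exact (hz i hi).1.trans ih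
  have hgen (r : K.compact.left) : K.emb.left (genericPoint K.sub.left) ⤳ r := by
    rw [specializes_iff_mem_closure]
    refine closure_minimal ?_ isClosed_closure (K.dense r)
    rintro _ ⟨r, rfl⟩
    exact ((genericPoint_specializes r).map K.emb.left.continuous).mem_closure
  obtain ⟨A, hA, hzA, -⟩ := exists_isAffineOpen_mem_and_subset
    (x := K.compact.hom (z m)) (U := ⊤) trivial
  obtain ⟨W, hW, hzW, hWA⟩ := exists_isAffineOpen_mem_and_subset
    (x := z m) (U := K.compact.hom ⁻¹ᵁ A) hzA
  obtain ⟨A', hA', hxA', -⟩ := exists_isAffineOpen_mem_and_subset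
    (x := X.hom x) (U := ⊤) trivial
  have : IsAffine A.toScheme := hA
  have : IsAffine A'.toScheme := hA'
  have : IsAffine W.toScheme := hW
  let TW : Over B := Over.mk (W.ι ≫ K.compact.hom)
  have : IsAffine TW.left := hW
  replace hWA : W ≤ K.compact.hom ⁻¹ᵁ A := hWA
  have : LocallyOfFiniteType (K.compact.hom.resLE A W hWA) := inferInstance
  obtain ⟨n, c, hc⟩ := ProjectiveSpace.exists_isImmersion_toOver TW
    (K.compact.hom.resLE A W hWA) A.ι (Scheme.Hom.resLE_comp_ι _ _)
  let S := K.emb.left ⁻¹ᵁ W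
  let e : S.toScheme ⟶ W.toScheme := K.emb.left ∣_ W
  have he : e ≫ W.ι = S.ι ≫ K.emb.left := morphismRestrict_ι _ _
  let ξ : S.toScheme := ⟨genericPoint K.sub.left, (hgen (z m)).mem_open W.isOpen hzW⟩
  have hξ : (S.ι ≫ K.incl.left) ξ = x := K.generic
  obtain ⟨U, N, φ, c', hUA', hU, hxU, hξN, hφ, hcc'⟩ := exists_appTop_eq (S.ι ≫ K.incl.left) ξ
    (e.appTop.hom ∘ c) (U₀ := X.hom ⁻¹ᵁ A') (by rw [hξ]; exact hxA')
  rw [hξ] at hxU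
  have : IsAffine U.toScheme := hU
  let T : Over B := Over.mk (U.ι ≫ X.hom)
  have : IsAffine T.left := hU
  -- The two morphisms to projective space agree near the generic point `ξ` of the closure of `x`.
  let N' : Over B := Over.mk (N.ι ≫ S.ι ≫ K.sub.hom)
  let Φ : N' ⟶ T := Over.homMk φ (by
    change φ ≫ U.ι ≫ X.hom = N.ι ≫ S.ι ≫ K.sub.hom
    rw [reassoc_of% hφ, Over.w])
  let Ψ : N' ⟶ TW := Over.homMk (N.ι ≫ e) (by
    change (N.ι ≫ e) ≫ W.ι ≫ K.compact.hom = N.ι ≫ S.ι ≫ K.sub.hom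
    rw [Category.assoc, reassoc_of% he, Over.w])
  have hΦΨ : Φ ≫ ProjectiveSpace.toOver T c' = Ψ ≫ ProjectiveSpace.toOver TW c := by
    rw [ProjectiveSpace.comp_toOver, ProjectiveSpace.comp_toOver]
    congr 1
    funext l
    refine (hcc' l).trans ?_
    change _ = (N.ι ≫ e).appTop.hom (c l)
    rw [Scheme.Hom.comp_appTop]
    rfl
  let t : T ⟶ X := Over.homMk U.ι rfl
  have : IsOpenImmersion t.left := inferInstanceAs (IsOpenImmersion U.ι)
  have : LocallyOfFiniteType (X.hom.resLE A' U hUA') := inferInstance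
  let x' : T.left := (⟨x, hxU⟩ : U)
  let η' : T.left := (⟨j.left y, h.mem_open U.isOpen hxU⟩ : U)
  have hx' : η' ⤳ x' := by
    rw [← U.ι.isEmbedding.isInducing.specializes_iff]
    exact h
  obtain ⟨K', G, κη, κx, hκ, hne, hG⟩ := exists_pointCompactification hj t
    (X.hom.resLE A' U hUA') A'.ι (Scheme.Hom.resLE_comp_ι _ _) (ProjectiveSpace.toOver T c')
    (η := η') (x := x') rfl hx'
  let z' (i : ℕ) : TW.left :=
    (⟨z (min i m), (hzm _ (min_le_right _ _)).mem_open W.isOpen hzW⟩ : W)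
  let ξ' : N.toScheme := ⟨ξ, hξN⟩
  have hφx : φ ξ' = x' := by
    refine U.ι.isOpenEmbedding.injective ?_
    change U.ι (φ ξ') = x
    rw [← Scheme.Hom.comp_apply, hφ]
    exact hξ
  have hGx : G.left κx = (ProjectiveSpace.toOver TW c).left (e ξ) := by
    have := congrArg (fun f => f.left ξ') hΦΨ
    rw [hG, ← hφx]
    exact this
  have hGc : IsClosedMap G.left := by
    have := K'.proper
    have : IsProper (G.left ≫ (ProjectiveSpace.spaceOver n B).hom) := by rwa [Over.w]
    have : IsProper G.left := IsProper.of_comp _ (ProjectiveSpace.spaceOver n B).hom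
    exact G.left.isClosedMap
  have hz' (i : ℕ) : z' i ⤳ z' (i + 1) := by
    rw [← W.ι.isEmbedding.isInducing.specializes_iff]
    change z (min i m) ⤳ z (min (i + 1) m)
    rcases lt_or_ge i m with hi | hi
    · rw [min_eq_left hi.le, min_eq_left hi]
      exact (hz i hi).1
    · rw [min_eq_right hi, min_eq_right (by omega)]
  have hz0 : e ξ ⤳ z' 0 := by
    rw [← W.ι.isEmbedding.isInducing.specializes_iff, ← Scheme.Hom.comp_apply, he]
    exact hgen _
  let w := (ProjectiveSpace.toOver TW c).left
  obtain ⟨s, hs0, hs, hGs⟩ := exists_chain_lift hGc (s := κx) (z := fun i => w (z' i))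
    (by rw [hGx]; exact hz0.map w.continuous) fun i => (hz' i).map w.continuous
  have hsne (i : ℕ) (hi : i < m) : s i ≠ s (i + 1) := fun e => by
    have h1 : w (z' i) = w (z' (i + 1)) := by rw [← hGs, ← hGs, e]
    have h2 := congrArg W.ι (w.isEmbedding.injective h1)
    refine (hz i hi).2 ?_
    have h3 : z (min i m) = z (min (i + 1) m) := h2
    rwa [min_eq_left hi.le, min_eq_left hi] at h3
  refine ⟨K', natCast_le_topologicalKrullDim_iff.2 ⟨s, fun i hi => ⟨hs i, hsne i hi⟩⟩, fun hyx =>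
    natCast_le_topologicalKrullDim_iff.2 ⟨fun i => Nat.casesOn i κη s, fun i hi => ?_⟩⟩
  cases i with
  | zero =>
    refine ⟨hκ.trans hs0, fun e => hne (fun e' => hyx (congrArg U.ι e')) ?_⟩
    have e : κη = s 0 := e
    exact hκ.antisymm (by rw [e]; exact hs0) |>.eq
  | succ i => exact ⟨hs i, hsne i (by omega)⟩

theorem nonempty_pointCompactification [IsLocallyNoetherian B] (X : Over B)
    [LocallyOfFiniteType X.hom] (x : X.left) : Nonempty (PointCompactification X x) := by
  obtain ⟨A, hA, hxA, -⟩ := exists_isAffineOpen_mem_and_subset (x := X.hom x) (U := ⊤) trivial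
  obtain ⟨U, hU, hxU, hUA⟩ := exists_isAffineOpen_mem_and_subset
    (x := x) (U := X.hom ⁻¹ᵁ A) hxA
  have : IsAffine A.toScheme := hA
  let T : Over B := Over.mk (U.ι ≫ X.hom)
  have : IsAffine T.left := hU
  let t : T ⟶ X := Over.homMk U.ι rfl
  have : IsOpenImmersion t.left := inferInstanceAs (IsOpenImmersion U.ι)
  replace hUA : U ≤ X.hom ⁻¹ᵁ A := hUA
  have : LocallyOfFiniteType (X.hom.resLE A U hUA) := inferInstance
  have : IsProper (Over.mk (𝟙 B)).hom := inferInstanceAs (IsProper (𝟙 B))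
  obtain ⟨K, -⟩ := exists_pointCompactification (isOpenImmersion_id X) (y := x) t
    (X.hom.resLE A U hUA) A.ι (Scheme.Hom.resLE_comp_ι _ _)
    (Over.homMk T.hom : T ⟶ Over.mk (𝟙 B)) (η := (⟨x, hxU⟩ : U)) (x := (⟨x, hxU⟩ : U)) rfl
    specializes_rfl
  exact ⟨K⟩

theorem closureDim_le_of_specializes [IsLocallyNoetherian B] {X V : Over B} {j : V ⟶ X}
    (hj : IsOpenImmersion j.left) [LocallyOfFiniteType X.hom] {y : V.left} {x : X.left}
    (h : j.left y ⤳ x) : closureDim X x ≤ closureDim V y := by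
  refine iSup_le fun K => natCast_le_of_forall fun m hm => ?_
  obtain ⟨K', hK', -⟩ := exists_le_topologicalKrullDim hj h K hm
  exact hK'.trans (le_iSup
    (fun K : PointCompactification V y => topologicalKrullDim K.compact.left) K')

theorem exists_closureDim_le [IsLocallyNoetherian B] {X V : Over B} {j : V ⟶ X}
    (hj : IsOpenImmersion j.left) [LocallyOfFiniteType X.hom] {y : V.left} {x : X.left}
    (h : j.left y ⤳ x) (hne : j.left y ≠ x) {n : ℕ} (hn : closureDim V y ≤ n) :
    ∃ k : ℕ, k + 1 ≤ n ∧ closureDim X x ≤ k := by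
  have key (K : PointCompactification X x) (m : ℕ)
      (hm : (m : WithBot ℕ∞) ≤ topologicalKrullDim K.compact.left) : m + 1 ≤ n := by
    obtain ⟨K', -, hK'⟩ := exists_le_topologicalKrullDim hj h K hm
    exact_mod_cast ((hK' hne).trans (le_iSup
      (fun K : PointCompactification V y => topologicalKrullDim K.compact.left) K')).trans hn
  obtain ⟨K⟩ := nonempty_pointCompactification X x
  have := K.integral
  have h0 := key K 0 (natCast_le_topologicalKrullDim_iff.2
    ⟨fun _ => K.emb.left (genericPoint K.sub.left), fun i hi => absurd hi (by omega)⟩)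
  refine ⟨n - 1, by omega, iSup_le fun K => natCast_le_of_forall fun m hm => ?_⟩
  have := key K m hm
  exact_mod_cast (show m ≤ n - 1 by omega)

end Niveau

namespace Niveau

variable {B : Scheme.{u}} {C : SchemeCat B}

/-! ### Dimension of closures -/

/-- A closed subset of a Noetherian scheme is the union of the closures of finitely many points, so
every point of the closure of its image specializes an image point. -/
theorem exists_specializes_of_mem_closure {V X : Scheme.{u}} (j : V ⟶ X) [NoetherianSpace V]
    {Z : Set V} (hZ : IsClosed Z) {x : X} (hx : x ∈ closure (j '' Z)) : ∃ y ∈ Z, j y ⤳ x := by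
  obtain ⟨S, hS, hSc, hSi, rfl⟩ := NoetherianSpace.exists_finite_set_isClosed_irreducible hZ
  rw [Set.sUnion_eq_biUnion, Set.image_iUnion₂, hS.closure_biUnion] at hx
  obtain ⟨T, hT, hxT⟩ := Set.mem_iUnion₂.1 hx
  obtain ⟨y, hy⟩ := QuasiSober.sober (hSi T hT) (hSc T hT)
  refine ⟨y, ⟨T, hT, hy ▸ subset_closure rfl⟩, ?_⟩
  rw [specializes_iff_mem_closure]
  have : j '' T ⊆ closure {j y} := by
    rintro _ ⟨t, ht, rfl⟩
    rw [← specializes_iff_mem_closure]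
    exact (specializes_iff_mem_closure.2 (by rw [hy.def]; exact ht)).map j.continuous
  exact closure_minimal this isClosed_closure hxT

/-- Taking closures in a bigger scheme does not increase the dimension. This is not formal, since
dimensions are measured on compactifications over `B`. -/
theorem DimLE.closure_image [IsLocallyNoetherian B] {X V : Over B} {j : V ⟶ X}
    (hj : IsOpenImmersion j.left) [LocallyOfFiniteType X.hom] [NoetherianSpace V.left]
    {Z : Set V.left} (hZ : IsClosed Z) {p : ℤ} (h : DimLE V Z p) :
    DimLE X (closure (j.left '' Z)) p := by
  intro x hx
  obtain ⟨y, hy, hyx⟩ := exists_specializes_of_mem_closure j.left hZ hx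
  obtain ⟨n, hn, hd⟩ := h y hy
  exact ⟨n, hn, (closureDim_le_of_specializes hj hyx).trans hd⟩

/-- The points added by taking the closure have smaller dimension. -/
theorem DimLE.closure_image_sdiff [IsLocallyNoetherian B] {X V : Over B} {j : V ⟶ X}
    (hj : IsOpenImmersion j.left) [LocallyOfFiniteType X.hom] [NoetherianSpace V.left]
    {Z : Set V.left} (hZ : IsClosed Z) {p : ℤ} (h : DimLE V Z p) :
    DimLE X (closure (j.left '' Z) \ Set.range j.left) (p - 1) := by
  rintro x ⟨hx, hxV⟩
  obtain ⟨y, hy, hyx⟩ := exists_specializes_of_mem_closure j.left hZ hx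
  obtain ⟨n, hn, hd⟩ := h y hy
  obtain ⟨k, hk, hkd⟩ := exists_closureDim_le hj hyx (fun e => hxV ⟨y, e⟩) hd
  exact ⟨k, by omega, hkd⟩

theorem DimLE.preimage_of_isClosedImmersion {X Y : Over B} {i : Y ⟶ X}
    (hi : IsClosedImmersion i.left) {Z : Set X.left} {p : ℤ}
    (h : DimLE X (Z ∩ Set.range i.left) p) : DimLE Y (i.left ⁻¹' Z) p := by
  intro y hy
  obtain ⟨n, hn, hd⟩ := h (i.left y) ⟨hy, y, rfl⟩
  exact ⟨n, hn, (closureDim_le_map i inferInstance y).trans hd⟩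

theorem noetherianSpace_of_schemeCat [IsNoetherian B] (V : C.Obj) : NoetherianSpace V.1.left := by
  have := C.locallyOfFiniteType V.1 V.2
  have := C.quasiCompact V.1 V.2
  have := LocallyOfFiniteType.isLocallyNoetherian V.1.hom
  have : CompactSpace V.1.left := QuasiCompact.compactSpace_of_compactSpace V.1.hom
  have : IsNoetherian V.1.left := { }
  infer_instance

namespace HomologyTheory

variable {R : Type v} [Ring R] (H : HomologyTheory.{u, v, w} C R) {X Y V : C.Obj}

/-- A class supported in dimension `≤ p` whose restriction to `V` dies in dimension `≤ m`, for some
`m > p`, comes in dimension `≤ m` from `Y`, even with support of dimension `≤ m - 1`: if the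
restriction dies on the closed subset `T` of `V`, the class comes from the part outside `V` of its
support and of the closure of `T`, and the closure of `T` gains only points of smaller dimension. -/
theorem exists_pushHZ_eq [IsNoetherian B] {i : Y.1 ⟶ X.1} {j : V.1 ⟶ X.1}
    (h : IsClosedOpenPair i j) {p m n : ℤ} (hp : p ≤ m - 1) {a : H.HZ X p n}
    (ha : H.incl V n (show p ≤ m by omega) (H.pullHZ h.isOpen p n a) = 0) :
    ∃ b : H.HZ Y (m - 1) n, H.pushHZ h.closed m n (H.incl Y n (show m - 1 ≤ m by omega) b) =
      H.incl X n (show p ≤ m by omega) a := by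
  have := noetherianSpace_of_schemeCat V
  have := C.locallyOfFiniteType X.1 X.2
  have := h.isOpen
  obtain ⟨Z, x, rfl⟩ := exists_toHZ a
  rw [pullHZ_toHZ, incl_toHZ] at ha
  obtain ⟨T, hT, h0⟩ := exists_of_toHZ_eq_zero ha
  have hT' : preimage j Z.1 ≤ T.1 := hT
  let W : Closeds X.1.left := Closeds.closure (j.left '' T.1) ⊔ Z.1
  have hZW : Z.1 ≤ W := le_sup_right
  have hjW : preimage j W = T.1 := by
    refine SetLike.coe_injective ?_
    change j.left ⁻¹' (closure (j.left '' T.1) ∪ Z.1) = T.1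
    rw [Set.preimage_union,
      ← j.left.isOpenEmbedding.isInducing.closure_eq_preimage_closure_image,
      T.1.isClosed.closure_eq]
    exact Set.union_eq_left.2 hT'
  have hW : DimLE X.1 W m := (T.2.closure_image h.isOpen T.1.isClosed).union (Z.2.mono (by omega))
  let S : Closeds Y.1.left := preimage i W
  have hS : DimLE Y.1 S (m - 1) := by
    refine DimLE.preimage_of_isClosedImmersion (Z := W) h.closed fun x hx => ?_
    have hxV : x ∉ Set.range j.left := by rw [h.range_eq]; exact not_not.2 hx.2
    rcases hx.1 with hx' | hx'
    · exact T.2.closure_image_sdiff h.isOpen T.1.isClosed x ⟨hx', hxV⟩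
    · exact Z.2.mono hp x hx'
  have hSW : (image h.closed S : Set X.1.left) = (W : Set X.1.left) ∩ Set.range i.left :=
    Set.image_preimage_eq_inter_range (f := i.left) (t := (W : Set X.1.left))
  have hSW' : image h.closed S ≤ W := fun x hx => (hSW.subset hx).1
  -- the restriction of the class to `W ∩ V = T` vanishes
  have hpull : H.closedPull h.isOpen n W (H.closedMap n Z.1 W hZW x) = 0 := by
    refine (LinearMap.congr_fun (H.closedPull_closedMap h.isOpen n hZW) x).trans ?_
    have key : ∀ (T' : Closeds V.1.left) (e : T' = T.1) (hle : preimage j Z.1 ≤ T'),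
        H.closedMap n _ T' hle (H.closedPull h.isOpen n Z.1 x) = 0 := by
      rintro _ rfl _
      exact h0
    exact key _ hjW _
  obtain ⟨t, ht⟩ := (H.pPush_pPull_exact n (closedIn_closedPiece hSW')
    (by
      rw [supp_map_closedPiece_preimage h.isOpen, supp_closedPiece, supp_closedPiece, hSW,
        Set.sdiff_self_inter, Set.sdiff_eq, h.range_eq])
    (openIn_closedPiece_preimage h.isOpen W) _).1 hpull
  obtain ⟨s, hs⟩ := (H.pPush_bijective_of_supp_eq n
    (closedIn_of_eq (supp_map_closedPiece h.closed S)) (supp_map_closedPiece h.closed S)).2 t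
  refine ⟨H.toHZ n ⟨S, hS⟩ s, ?_⟩
  have hle : (⟨Z.1, Z.2.mono (by omega)⟩ : ClosedLE X m) ≤ ⟨W, hW⟩ := hZW
  have hle' : (⟨image h.closed S, (hS.mono (by omega)).image h.closed⟩ : ClosedLE X m) ≤ ⟨W, hW⟩ :=
    hSW'
  rw [incl_toHZ, pushHZ_toHZ, incl_toHZ, ← toHZ_closedMap hle, ← toHZ_closedMap hle']
  rw [← hs] at ht
  exact congrArg _ ht

end HomologyTheory

end Niveau

theorem theorem1p2 {B : Scheme.{u}} [IsNoetherian B] [ConnectedSpace B]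
    (hB : ∀ b : B, IsRegularLocalRing (B.presheaf.stalk b))
    (C : Niveau.SchemeCat B) {R : Type v} [Ring R] (H : Niveau.HomologyTheory.{u, v, w} C R)
    {X Y V : C.Obj} (i : Y.1 ⟶ X.1) (j : V.1 ⟶ X.1) (hij : Niveau.IsClosedOpenPair i j)
    (p q : ℤ) (hp : 0 ≤ p) (hq : 0 ≤ q) (e : ℤ) (he : 1 - q ≤ e)
    (hV : ∀ a : ℤ, 1 ≤ a → Subsingleton (H.ZinfB V (p - a) (q + a) (q + a + e).toNat))
    (hY : ∀ a : ℤ, -(q + e - 1) ≤ a → a ≤ -1 →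
      Subsingleton (H.ZinfB Y (p - a) (q + a) (q + a + e).toNat)) :
    Function.Exact (H.pushZinfB hij.closed p q (q + e).toNat)
      (H.pullZinfB hij.isOpen p q (q + e).toNat) := by
  -- the common dimension `p - a + (q + a + e)` up to which supports may grow
  obtain ⟨m, hm⟩ : ∃ m, p + ((q + e).toNat : ℤ) = m := ⟨_, rfl⟩
  have hpm : p ≤ m - 1 := by omega
  have hV' : ∀ s ≤ p - 1, Subsingleton (H.ZinfB V s (p + q - s) (m - s).toNat) := fun s hs => by
    have h := hV (p - s) (by omega)
    rwa [show p - (p - s) = s by omega, show q + (p - s) = p + q - s by omega,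
      show p + q - s + e = m - s by omega] at h
  have hY' : ∀ s, p < s → s ≤ m - 1 → Subsingleton (H.ZinfB Y s (p + q - s) (m - s).toNat) :=
    fun s hs hs' => by
      have h := hY (p - s) (by omega) (by omega)
      rwa [show p - (p - s) = s by omega, show q + (p - s) = p + q - s by omega,
        show p + q - s + e = m - s by omega] at h
  have hpm0 : p ≤ m := by omega
  have hpm1 : p - 1 ≤ m := by omega
  obtain ⟨k, hk, hkm⟩ : ∃ k : ℕ, p + k = m - 1 ∧ p + k ≤ m :=
    ⟨(m - 1 - p).toNat, by omega, by omega⟩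
  intro ξ
  obtain ⟨⟨ξ, hξ⟩, rfl⟩ := Submodule.Quotient.mk_surjective _ ξ
  constructor
  · intro h0
    obtain ⟨α, rfl⟩ := H.exists_proj_eq_of_mem_Zinf hξ
    have h1 : H.proj V p (p + q) (H.pullHZ hij.isOpen p (p + q) α) ∈
        H.Bsub V p q (q + e).toNat := by
      rw [← LinearMap.comp_apply, ← H.pullHZZ_proj hij.isOpen p (p + q)]
      exact (H.pullZinfB_mk_eq_zero_iff hij.isOpen _).1 h0
    -- The restriction of `α` comes from dimension `≤ p - 1`, where by `hV` nothing survives.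
    obtain ⟨ε, hε⟩ := (H.proj_mem_Bsub_iff hm hpm0 _).1 h1
    have hε0 : H.incl V (p + q) hpm1 ε = 0 :=
      H.incl_eq_zero_of_forall (m := m) (n := p + q) hpm1 hV' ε
    rw [hε0] at hε
    -- So `α` comes from `Y` in dimension `≤ m - 1`, which by `hY` can be lowered to `p`.
    obtain ⟨β, hβ⟩ := H.exists_pushHZ_eq hij hpm hε.symm
    obtain ⟨η, hη⟩ := H.exists_incl_eq_incl_of_forall (m := m) (n := p + q) (s' := p) k hkm
      (fun s hs hs' => hY' s hs (hs'.trans hk.le))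
      (H.incl Y (p + q) hk.ge β)
    rw [Niveau.HomologyTheory.incl_incl] at hη
    refine ⟨Submodule.Quotient.mk ⟨H.proj Y p (p + q) η, H.proj_mem_Zinf η⟩,
      (H.pushZinfB_mk_eq_mk_iff hij.closed _ _).2 ?_⟩
    have h2 : H.pushHZZ hij.closed p (p + q) (H.proj Y p (p + q) η) - H.proj X p (p + q) α =
        H.proj X p (p + q) (H.pushHZ hij.closed p (p + q) η - α) := by
      rw [map_sub, ← LinearMap.comp_apply, H.pushHZZ_proj hij.closed p (p + q),
        LinearMap.comp_apply]
    refine h2 ▸ (H.proj_mem_Bsub_iff hm hpm0 _).2 ⟨0, ?_⟩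
    have h3 := LinearMap.congr_fun (H.pushHZ_incl hij.closed (p + q) hpm0) η
    rw [LinearMap.comp_apply, LinearMap.comp_apply, hη, hβ] at h3
    rw [map_zero, map_sub, ← h3, sub_self]
  · rintro ⟨η, hη⟩
    rw [← hη]
    exact H.pullZinfB_pushZinfB hij η
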